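/- Let $\omega=e^{2\pi i/3}$, $k=\mathbb{Q}(\omega)$, $\mathscr{O}_k=\mathbb{Z}[\omega]$, and let $n$ be a positive integer relatively prime to $6$ such that $n\not\equiv\pm1\pmod 9$ and no exponent in the prime factorization of $n$ is a multiple of $3$. Let $n'$ be the largest squarefree divisor of $n$, let $n=\prod_i\lambda_i^{c_i}$ be the prime factorization of $n$ in $\mathscr{O}_k$, and let $\left(\frac{z}{\lambda}\right)_3\in\{0,1,\omega,\omega^2\}$ be the cubic residue symbol: it is $0$ if $\lambda\mid z$, and otherwise the cube root of unity congruent to $z^{(N\lambda-1)/3}$ modulo $\lambda$. For $d\mid n$ put $f(d)=d\prod_{p\mid d}\bigl[1-p^{-1}\left(\frac p3\right)\bigr]$. For relatively prime integers $\alpha,\beta$ put $\delta=\gcd(n,\alpha^2+\alpha\beta+\beta^2)$ and $$C(\alpha,\beta)=\sum_{\substack{d\mid n\\ \gcd(d,\delta)=1}}d^2\frac{f(n)}{3f(d)}\prod_{p\mid d}(1-p^{-2})+\frac23\,\mathrm{Re}\prod_i\left(\frac{\alpha-\beta\omega}{\lambda_i}\right)_3^{c_i}\sum_{n'\mid d\mid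 n}dn\prod_{p\mid d}(1-p^{-2}).$$ With $T=\begin{pmatrix}1&1\\0&1\end{pmatrix}$ and $S=\begin{pmatrix}0&-1\\1&0\end{pmatrix}$, define for $\tau$ in the upper half-plane and $\mathrm{Re}\, s>1$ $$F(\tau,s)=\frac{2\pi}{3n}\sum_{\gamma=\begin{pmatrix}a&b\\c&d\end{pmatrix}\in\langle T^3\rangle\backslash\Gamma(3)}\bigl[C(d,-c)(\mathrm{Im}\,\gamma\tau)^s-C(c,d)(\mathrm{Im}\,\gamma S\tau)^s\bigr].$$ Then there is a character $\chi\colon(\mathscr{O}_k/3n\mathscr{O}_k)^\times\to\mathbb{C}^\times$ with $\chi(z)=\prod_i\left(\frac{z}{\lambda_i}\right)_3^{c_i}$ for all $z\in\mathscr{O}_k$ prime to $3n$. Let $$L_k(s,\chi)=\sum_{I}\chi(I)\,(NI)^{-s},$$ where $I$ runs over the ideals of $\mathscr{O}_k$ prime to $3n$, and $\chi(I)=\chi(\alpha)$ for the unique generator $\alpha$ of $I$ with $\alpha\equiv1\pmod 3$. For every $s\in\mathbb{C}$ with $\mathrm{Re}\, s>1$, the series defining $F(\omega,s)$ and $L_k(s,\chi)$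 converge absolutely, and $$F(\omega,s)=\frac{2\pi n'\sigma(n/n')}{3(1-3^{-2s})}\left(\frac{\sqrt3}{2}\right)^{s}\frac{L_k(s,\chi)}{\zeta(2s)}\prod_{p\mid n}\frac{1-p^{-2}}{1-p^{-2s}},$$ where $\sigma$ is the sum-of-divisors function and $\zeta$ is the Riemann zeta function. -/

import Mathlib

open scoped MatrixGroups NumberField

noncomputable section

namespace CubicEisenstein

/-! ### The field `k = ℚ(ω)` and its ring of integers -/

/-- `ω = e^{2πi/3}`. -/
def omega : ℂ := Complex.exp (2 * Real.pi * Complex.I / 3)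

theorem omega_isPrimitiveRoot : IsPrimitiveRoot omega 3 := by
  have h := Complex.isPrimitiveRoot_exp 3 (by norm_num)
  simpa [omega] using h

/-- The quadratic field `k = ℚ(ω)`, as a subfield of `ℂ`. -/
abbrev k : IntermediateField ℚ ℂ := IntermediateField.adjoin ℚ {omega}

instance k_isCyclotomicExtension : IsCyclotomicExtension {3} ℚ k :=
  by
    have h := omega_isPrimitiveRoot.adjoin_isCyclotomicExtension ℚ
    have hint : IsIntegral ℚ omega := omega_isPrimitiveRoot.isIntegral (by norm_num) |>.tower_top
    have e : k.toSubalgebra = Algebra.adjoin ℚ {omega} :=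
      IntermediateField.adjoin_simple_toSubalgebra_of_isAlgebraic hint.isAlgebraic
    change IsCyclotomicExtension {3} ℚ k.toSubalgebra
    rw [e]
    exact h

instance k_numberField : NumberField k :=
  IsCyclotomicExtension.numberField {3} ℚ k

theorem omega_im_pos : 0 < omega.im := by
  have h : (2 * (Real.pi : ℂ) * Complex.I / 3) = ((2 * Real.pi / 3 : ℝ) : ℂ) * Complex.I := by
    push_cast; ring
  rw [omega, h, Complex.exp_ofReal_mul_I_im]
  exact Real.sin_pos_of_pos_of_lt_pi (by positivity) (by linarith [Real.pi_pos])

/-- `ω` as a point of the upper half-plane. -/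
def omegaH : UpperHalfPlane := ⟨omega, omega_im_pos⟩

/-- `ω` as an element of `𝓞 k`. -/
def omegaO : 𝓞 k :=
  ⟨⟨omega, IntermediateField.mem_adjoin_simple_self ℚ omega⟩, by
    refine ⟨Polynomial.X ^ 3 - 1, Polynomial.monic_X_pow_sub_C 1 (by norm_num), ?_⟩
    apply Subtype.ext
    simp [omega_isPrimitiveRoot.pow_eq_one]⟩

/-! ### Cubic residue symbols and the product `∏ᵢ (z/λᵢ)₃^{cᵢ}` -/

open Classical in
/-- The cubic residue symbol `(z/P)₃ ∈ {0, 1, ω, ω²}` modulo a prime ideal `P ∤ 3` of `𝓞 k`: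
it is `0` if `z ∈ P`, and otherwise the cube root of unity congruent to `z^{(NP-1)/3}` modulo `P`.
(Only used for primes `P ∤ 3`.) -/
def cubicSymbol (P : Ideal (𝓞 k)) (z : 𝓞 k) : ℂ :=
  if z ∈ P then 0
  else if z ^ ((Ideal.absNorm P - 1) / 3) - 1 ∈ P then 1
  else if z ^ ((Ideal.absNorm P - 1) / 3) - omegaO ∈ P then omega
  else if z ^ ((Ideal.absNorm P - 1) / 3) - omegaO ^ 2 ∈ P then omega ^ 2
  else 0

/-- `∏ᵢ (z/λᵢ)₃^{cᵢ}`, where `n = ∏ᵢ λᵢ^{cᵢ}` is the prime factorization of `n` in `𝓞 k`; the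
product runs over the prime ideal factors `(λᵢ)` of `(n)`, with multiplicity. -/
def cubicProd (n : ℕ) (z : 𝓞 k) : ℂ :=
  ((UniqueFactorizationMonoid.normalizedFactors (Ideal.span {(n : 𝓞 k)})).map
    fun P => cubicSymbol P z).prod

/-! ### The weights `C(α, β)` -/

/-- The largest squarefree divisor `n'` of `n`. -/
def largestSquarefreeDivisor (n : ℕ) : ℕ := (n.divisors.filter Squarefree).sup id

/-- `f(d) = d ∏_{p ∣ d} (1 - p⁻¹ (p/3))`. -/
def f (d : ℕ) : ℝ := d * ∏ p ∈ d.primeFactors, (1 - (p : ℝ)⁻¹ * (legendreSym 3 (p : ℤ) : ℝ))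

/-- `δ = gcd(n, α² + αβ + β²)`. -/
def delta (n : ℕ) (α β : ℤ) : ℕ := Int.gcd (n : ℤ) (α ^ 2 + α * β + β ^ 2)

/-- The weight `C(α, β)`. -/
def C (n : ℕ) (α β : ℤ) : ℝ :=
  (∑ d ∈ n.divisors with Nat.gcd d (delta n α β) = 1,
    (d : ℝ) ^ 2 * (f n / (3 * f d)) * ∏ p ∈ d.primeFactors, (1 - ((p : ℝ) ^ 2)⁻¹))
  + 2 / 3 * (cubicProd n ((α : 𝓞 k) - (β : 𝓞 k) * omegaO)).re *
    ∑ d ∈ n.divisors with largestSquarefreeDivisor n ∣ d,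
      (d : ℝ) * (n : ℝ) * ∏ p ∈ d.primeFactors, (1 - ((p : ℝ) ^ 2)⁻¹)

/-! ### The weighted sum of Eisenstein series `F(τ, s)` -/

/-- `⟨T³⟩`, as a subgroup of `Γ(3)`. -/
def T3 : Subgroup (CongruenceSubgroup.Gamma 3) :=
  (Subgroup.zpowers (ModularGroup.T ^ 3)).subgroupOf (CongruenceSubgroup.Gamma 3)

/-- The set `⟨T³⟩ \ Γ(3)` of cosets `⟨T³⟩γ`. -/
abbrev Cosets : Type := Quotient (QuotientGroup.rightRel T3)

/-- `C(d, -c) (Im γτ)^s - C(c, d) (Im γSτ)^s` for a matrix `γ` with bottom row `(c, d)`. -/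
def termAt (n : ℕ) (τ : UpperHalfPlane) (s : ℂ) (γ : SL(2, ℤ)) : ℂ :=
  (C n (γ 1 1) (-(γ 1 0)) : ℂ) * ((γ • τ).im : ℂ) ^ s
    - (C n (γ 1 0) (γ 1 1) : ℂ) * ((γ • (ModularGroup.S • τ)).im : ℂ) ^ s

theorem termAt_T_zpow_mul (n : ℕ) (τ : UpperHalfPlane) (s : ℂ) (m : ℤ) (γ : SL(2, ℤ)) :
    termAt n τ s (ModularGroup.T ^ m * γ) = termAt n τ s γ := by
  have h : (ModularGroup.T ^ m * γ) 1 = γ 1 := ModularGroup.T_pow_mul_apply_one m γ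
  simp only [termAt, h, mul_smul, ModularGroup.im_T_zpow_smul]

/-- The summand of `F(τ, s)`, as a function on `⟨T³⟩ \ Γ(3)`. -/
def cosetTerm (n : ℕ) (τ : UpperHalfPlane) (s : ℂ) : Cosets → ℂ :=
  Quotient.lift (fun γ : CongruenceSubgroup.Gamma 3 => termAt n τ s γ) (by
    intro x y hxy
    have h : y * x⁻¹ ∈ T3 := QuotientGroup.rightRel_apply.1 hxy
    rw [T3, Subgroup.mem_subgroupOf] at h
    obtain ⟨m, hm⟩ := Subgroup.mem_zpowers_iff.1 h
    have hy : (y : SL(2, ℤ)) = ModularGroup.T ^ (3 * m) * (x : SL(2, ℤ)) := by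
      rw [zpow_mul, zpow_ofNat, hm]; simp
    show termAt n τ s x = termAt n τ s y
    rw [hy, termAt_T_zpow_mul])

/-- `F(τ, s) = (2π / 3n) ∑_{γ ∈ ⟨T³⟩ \ Γ(3)} [C(d, -c) (Im γτ)^s - C(c, d) (Im γSτ)^s]`. -/
def F (n : ℕ) (τ : UpperHalfPlane) (s : ℂ) : ℂ :=
  2 * Real.pi / (3 * n) * ∑' q : Cosets, cosetTerm n τ s q

/-! ### `L`-functions over `k` -/

/-- The ideal `3n 𝓞 k`. -/
abbrev modulus (n : ℕ) : Ideal (𝓞 k) := Ideal.span {((3 * n : ℕ) : 𝓞 k)}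

open Classical in
/-- The value of a character `χ` modulo `3n` on an ideal `I`. An ideal `I` prime to `3` has exactly
one generator `α ≡ 1` modulo `3`, and its value is `χ(α)`; other ideals have value `0`. -/
def idealValue {n : ℕ} (χ : MulChar (𝓞 k ⧸ modulus n) ℂ) (I : Ideal (𝓞 k)) : ℂ :=
  if h : ∃ α : 𝓞 k, I = Ideal.span {α} ∧ α - 1 ∈ Ideal.span {(3 : 𝓞 k)} then
    χ (Ideal.Quotient.mk (modulus n) h.choose)
  else 0

/-- The term `χ(I) N(I)^{-s}` of the `L`-series of `χ`. -/
def lTerm {n : ℕ} (χ : MulChar (𝓞 k ⧸ modulus n) ℂ) (s : ℂ) (I : Ideal (𝓞 k)) : ℂ :=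
  idealValue χ I * (Ideal.absNorm I : ℂ) ^ (-s)

/-- `L_k(s, χ) = ∑_I χ(I) N(I)^{-s}`. The zero ideal does not contribute. -/
def Lk {n : ℕ} (s : ℂ) (χ : MulChar (𝓞 k ⧸ modulus n) ℂ) : ℂ :=
  ∑' I : Ideal (𝓞 k), lTerm χ s I

end CubicEisenstein

end

open scoped MatrixGroups NumberField ComplexConjugate

noncomputable section

namespace CubicEisenstein

/-! ### Arithmetic of `ℤ[ω]` -/

/-! At `τ = ω` the Eisenstein series become sums over `ℤ[ω]`. If `γ` has bottom row `(c, d)`, then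
`Im γω = (√3/2) / N(d + cω)`, and `⟨T³⟩ \ Γ(3)` corresponds to the primitive pairs `(d, c)` with `d
+ cω ≡ 1` modulo `3` (`cosetRow_bijective`). Replacing `γ` by `γS` replaces `d + cω`, up to a unit,
by `(d + c) + cω`, and the shift `(d, c) ↦ (d + c, c)` permutes these pairs.

Each weight is a function of the norm plus a multiple of `Re χ`. By `C_neg_right` and `C_swap`, the
two weights in a summand have the same norm part, evaluated at `d + cω` and at its shift; they
differ only in that the second carries an extra `χ(ω)` inside the real part. After reindexing by the
shift the norm parts cancel. Complex conjugation permutes the pairs and turns `χ` into its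
conjugate, so `∑ Re(η χ) N^{-s} = Re η · ∑ χ N^{-s}` (`hasSum_re_mul_charVal`). Since `χ(ω) = ω^{(n²
- 1)/3}` and `n ≢ ±1` modulo `9`, `Re χ(ω) = -1/2` (`cubicProd_omegaO_re`), and the coefficient is
`(2/3)(1 + 1/2) = 1`.

What remains is the sum of `χ N^{-s}` over primitive primary elements. Every primary element is
uniquely a rational integer `e ≡ 1` modulo `3` times a primitive one, and `χ(e) = 1` when `e` is
prime to `3n`, because it is a real cube root of unity. Hence `L_k(s, χ)` is the primitive sum times
`ζ(2s)` without its Euler factors at primes dividing `3n` (`Lk_eq_mul_primitiveSum`). Finally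
`characterWeight_eq` evaluates the divisor sum multiplying `Re χ`. -/

theorem omega_cube : omega ^ 3 = 1 := omega_isPrimitiveRoot.pow_eq_one

theorem omega_sq_add : omega ^ 2 + omega + 1 = 0 := by
  have h1 : omega - 1 ≠ 0 := sub_ne_zero.2 (omega_isPrimitiveRoot.ne_one (by norm_num))
  have h : (omega - 1) * (omega ^ 2 + omega + 1) = 0 := by
    linear_combination omega_cube
  exact (mul_eq_zero.1 h).resolve_left h1

theorem conj_omega : conj omega = omega ^ 2 := by
  have h : ‖omega‖ = 1 := omega_isPrimitiveRoot.norm'_eq_one (by norm_num)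
  have h2 : omega * conj omega = 1 := by
    rw [Complex.mul_conj, Complex.normSq_eq_norm_sq, h]; norm_num
  have h0 : omega ≠ 0 := omega_isPrimitiveRoot.ne_zero (by norm_num)
  apply mul_left_cancel₀ h0
  rw [h2]; linear_combination -omega_cube

theorem omega_re : omega.re = -1 / 2 := by
  have h := congrArg Complex.re (show omega + conj omega = -1 by
    rw [conj_omega]; linear_combination omega_sq_add)
  simp only [Complex.add_re, Complex.conj_re, Complex.neg_re, Complex.one_re] at h
  linarith

theorem omega_sq_re : (omega ^ 2).re = -1 / 2 := by
  rw [← conj_omega, Complex.conj_re, omega_re]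

theorem omega_im : omega.im = Real.sqrt 3 / 2 := by
  have h : (2 * (Real.pi : ℂ) * Complex.I / 3) = ((2 * Real.pi / 3 : ℝ) : ℂ) * Complex.I := by
    push_cast; ring
  rw [omega, h, Complex.exp_ofReal_mul_I_im,
    show 2 * Real.pi / 3 = Real.pi - Real.pi / 3 by ring, Real.sin_pi_sub, Real.sin_pi_div_three]

/-- The embedding `𝓞 k → ℂ`. -/
def toC : 𝓞 k →+* ℂ := (algebraMap k ℂ).comp (algebraMap (𝓞 k) k)

theorem toC_injective : Function.Injective toC :=
  (algebraMap k ℂ).injective.comp NumberField.RingOfIntegers.coe_injective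

@[simp] theorem toC_omegaO : toC omegaO = omega := rfl

theorem omegaO_cube : omegaO ^ 3 = 1 := toC_injective (by simp [omega_cube])

theorem omegaO_sq_add : omegaO ^ 2 + omegaO + 1 = 0 := toC_injective (by simp [omega_sq_add])

theorem omegaO_pow_mod (j : ℕ) : omegaO ^ j = omegaO ^ (j % 3) := by
  conv_lhs => rw [← Nat.div_add_mod j 3, pow_add, pow_mul, omegaO_cube, one_pow, one_mul]

theorem omega_pow_mod (j : ℕ) : omega ^ j = omega ^ (j % 3) := by
  conv_lhs => rw [← Nat.div_add_mod j 3, pow_add, pow_mul, omega_cube, one_pow, one_mul]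

/-- The element `a + bω` of `𝓞 k`. -/
def eis (a b : ℤ) : 𝓞 k := a + b * omegaO

theorem toC_eis (a b : ℤ) : toC (eis a b) = a + b * omega := by simp [eis]

theorem eis_injective {a b c d : ℤ} (h : eis a b = eis c d) : a = c ∧ b = d := by
  have h := congrArg toC h
  rw [toC_eis, toC_eis] at h
  have him := congrArg Complex.im h
  have hre := congrArg Complex.re h
  simp at him hre
  have hb : (b : ℝ) = d := by
    rcases him with h | h
    · exact_mod_cast h
    · exact absurd h omega_im_pos.ne'
  have hb' : b = d := by exact_mod_cast hb
  subst hb'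
  refine ⟨?_, rfl⟩
  have : (a : ℝ) = c := by linarith
  exact_mod_cast this

theorem eis_mul (a b c d : ℤ) :
    eis a b * eis c d = eis (a * c - b * d) (a * d + b * c - b * d) := by
  simp only [eis]; push_cast
  linear_combination (b * d : 𝓞 k) * omegaO_sq_add

theorem omegaO_isPrimitiveRoot : IsPrimitiveRoot (omegaO : k) 3 := by
  refine IsPrimitiveRoot.of_map_of_injective (f := algebraMap k ℂ) ?_ (algebraMap k ℂ).injective
  exact omega_isPrimitiveRoot

/-- The ring of integers of a cyclotomic field of prime conductor is generated by the root of unity,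
and `ω² = -1 - ω` reduces every polynomial in `ω` to degree at most one. -/
theorem exists_eq_eis (z : 𝓞 k) : ∃ a b : ℤ, z = eis a b := by
  have hz : z ∈ Algebra.adjoin ℤ {omegaO} := by
    have := IsCyclotomicExtension.Rat.isIntegralClosure_adjoin_singleton omegaO_isPrimitiveRoot
    obtain ⟨y, hy⟩ := (this.isIntegral_iff (x := (z : k))).1 z.isIntegral_coe
    have : ∀ y ∈ Algebra.adjoin ℤ {(omegaO : k)}, ∃ w ∈ Algebra.adjoin ℤ {omegaO}, (w : k) = y := by
      intro y hy
      have h : Algebra.adjoin ℤ {(omegaO : k)} =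
          (Algebra.adjoin ℤ {omegaO}).map (Algebra.ofId (𝓞 k) k |>.restrictScalars ℤ) := by
        rw [AlgHom.map_adjoin, Set.image_singleton]; rfl
      rw [h] at hy
      exact hy
    obtain ⟨w, hw, hwy⟩ := this y.1 y.2
    have : w = z := by
      apply NumberField.RingOfIntegers.coe_injective
      exact hwy.trans hy
    exact this ▸ hw
  induction hz using Algebra.adjoin_induction with
  | mem x hx => exact ⟨0, 1, by rw [Set.mem_singleton_iff.1 hx]; simp [eis]⟩
  | algebraMap r => exact ⟨r, 0, by simp [eis]⟩
  | add x y _ _ hx hy =>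
    obtain ⟨a, b, rfl⟩ := hx
    obtain ⟨c, d, rfl⟩ := hy
    exact ⟨a + c, b + d, by simp only [eis]; push_cast; ring⟩
  | mul x y _ _ hx hy =>
    obtain ⟨a, b, rfl⟩ := hx
    obtain ⟨c, d, rfl⟩ := hy
    exact ⟨_, _, eis_mul a b c d⟩

/-- The norm form `a² - ab + b²` of `ℤ[ω]`. -/
def normForm (a b : ℤ) : ℤ := a ^ 2 - a * b + b ^ 2

theorem normSq_eis (a b : ℤ) : Complex.normSq (a + b * omega) = normForm a b := by
  have h : (Complex.normSq (a + b * omega) : ℂ) = normForm a b := by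
    rw [← Complex.mul_conj]
    simp only [map_add, map_mul, conj_omega, normForm, map_intCast]
    push_cast
    linear_combination (a * b : ℂ) * omega_sq_add + (b ^ 2 : ℂ) * omega_cube
  exact_mod_cast h

/-- Completing the square in either variable bounds each coordinate by the norm. -/
theorem four_mul_normForm (a b : ℤ) : 4 * normForm a b = (2 * a - b) ^ 2 + 3 * b ^ 2 := by
  simp only [normForm]; ring

theorem four_mul_normForm' (a b : ℤ) : 4 * normForm a b = (2 * b - a) ^ 2 + 3 * a ^ 2 := by
  simp only [normForm]; ring

theorem normForm_nonneg (a b : ℤ) : 0 ≤ normForm a b := by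
  nlinarith [four_mul_normForm a b, sq_nonneg (2 * a - b), sq_nonneg b]

theorem normForm_pos {a b : ℤ} (h : (a, b) ≠ 0) : 0 < normForm a b := by
  refine lt_of_le_of_ne (normForm_nonneg a b) fun h0 => h ?_
  have hb : b = 0 := by
    nlinarith [four_mul_normForm a b, sq_nonneg (2 * a - b), sq_nonneg b]
  have ha : a = 0 := by
    nlinarith [four_mul_normForm' a b, sq_nonneg (2 * b - a), sq_nonneg a]
  simp [ha, hb]

/-- `a + bω ≡ 1` modulo `3`. -/
def Primary (a b : ℤ) : Prop := a % 3 = 1 ∧ b % 3 = 0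

theorem Primary.ne_zero {a b : ℤ} (h : Primary a b) : (a, b) ≠ 0 := by
  intro h0
  obtain ⟨h1, -⟩ := h
  rw [(Prod.mk.inj h0).1] at h1
  omega

theorem eis_sub_one_mem_iff (a b : ℤ) :
    eis a b - 1 ∈ Ideal.span {(3 : 𝓞 k)} ↔ Primary a b := by
  rw [Ideal.mem_span_singleton]
  constructor
  · rintro ⟨w, hw⟩
    obtain ⟨c, d, rfl⟩ := exists_eq_eis w
    have : eis (a - 1) b = eis (3 * c) (3 * d) := by
      simp only [eis] at hw ⊢
      push_cast
      linear_combination hw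
    obtain ⟨h1, h2⟩ := eis_injective this
    constructor <;> omega
  · rintro ⟨h1, h2⟩
    refine ⟨eis (a / 3) (b / 3), ?_⟩
    have ha : a = 3 * (a / 3) + 1 := by omega
    have hb : b = 3 * (b / 3) := by omega
    have ha' := congrArg (Int.cast : ℤ → 𝓞 k) ha
    have hb' := congrArg (Int.cast : ℤ → 𝓞 k) hb
    push_cast at ha' hb'
    simp only [eis]
    linear_combination ha' + omegaO * hb'

/-- Two generators differ by a unit. A unit has norm `1`, hence is one of the six `±ωʲ`, and only
`1` preserves the class of `1` modulo `3`. -/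
theorem span_eis_injective {a b c d : ℤ} (h1 : Primary a b) (h2 : Primary c d)
    (h : Ideal.span {eis a b} = Ideal.span {eis c d}) : a = c ∧ b = d := by
  obtain ⟨u, hu⟩ := Ideal.span_singleton_eq_span_singleton.1 h
  obtain ⟨x, y, hxy⟩ := exists_eq_eis (u : 𝓞 k)
  obtain ⟨x', y', hxy'⟩ := exists_eq_eis (↑u⁻¹ : 𝓞 k)
  have hn : normForm x y = 1 := by
    have hone : toC (u : 𝓞 k) * toC (↑u⁻¹ : 𝓞 k) = 1 := by rw [← map_mul]; simp
    rw [hxy, hxy', toC_eis, toC_eis] at hone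
    have := congrArg Complex.normSq hone
    rw [Complex.normSq_mul, normSq_eis, normSq_eis, map_one] at this
    have h' : normForm x y * normForm x' y' = 1 := by exact_mod_cast this
    exact Int.eq_one_of_mul_eq_one_right (normForm_nonneg x y) h'
  rw [hxy, eis_mul] at hu
  obtain ⟨e1, e2⟩ := eis_injective hu
  obtain ⟨ha, hb⟩ := h1
  obtain ⟨hc, hd⟩ := h2
  have f1 := four_mul_normForm x y
  have f2 := four_mul_normForm' x y
  rw [hn] at f1 f2
  have hx1 : x ≤ 1 := by nlinarith [sq_nonneg (2 * y - x)]
  have hx2 : -1 ≤ x := by nlinarith [sq_nonneg (2 * y - x)]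
  have hy1 : y ≤ 1 := by nlinarith [sq_nonneg (2 * x - y)]
  have hy2 : -1 ≤ y := by nlinarith [sq_nonneg (2 * x - y)]
  interval_cases x <;> interval_cases y <;> simp [normForm] at hn <;> omega

/-- Complex conjugation on `𝓞 k`. -/
def conjO : 𝓞 k ≃+* 𝓞 k :=
  have : IsGalois ℚ k := IsCyclotomicExtension.isGalois {3} ℚ k
  NumberField.RingOfIntegers.mapRingEquiv
    ((Complex.conjAe.restrictScalars ℚ).restrictNormal k).toRingEquiv

theorem toC_conjO (z : 𝓞 k) : toC (conjO z) = conj (toC z) := by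
  have : IsGalois ℚ k := IsCyclotomicExtension.isGalois {3} ℚ k
  exact AlgEquiv.restrictNormal_commutes (Complex.conjAe.restrictScalars ℚ) k (z : k)

theorem conjO_omegaO : conjO omegaO = omegaO ^ 2 :=
  toC_injective (by rw [toC_conjO, map_pow, toC_omegaO, conj_omega])

theorem conjO_eis (a b : ℤ) : conjO (eis a b) = eis (a - b) (-b) := by
  simp only [eis, map_add, map_mul, map_intCast, conjO_omegaO]
  push_cast
  linear_combination (b : 𝓞 k) * omegaO_sq_add

theorem absNorm_map_conjO (I : Ideal (𝓞 k)) : Ideal.absNorm (I.map conjO) = Ideal.absNorm I := by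
  rw [Ideal.absNorm_apply, Ideal.absNorm_apply]
  exact (Nat.card_congr (Ideal.quotientEquiv I (I.map conjO) conjO rfl).toEquiv).symm

theorem finrank_int : Module.finrank ℤ (𝓞 k) = 2 := by
  rw [NumberField.RingOfIntegers.rank, IsCyclotomicExtension.Rat.finrank 3 k]; decide

/-- Conjugate ideals have the same norm, and the product of conjugate generators is the rational
integer `normForm a b`, whose ideal norm is its square because `𝓞 k` has rank `2`. -/
theorem absNorm_span_eis (a b : ℤ) :
    (Ideal.absNorm (Ideal.span {eis a b}) : ℤ) = normForm a b := by
  have h1 : Ideal.absNorm (Ideal.span {eis (a - b) (-b)}) = Ideal.absNorm (Ideal.span {eis a b}) := by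
    rw [← absNorm_map_conjO (Ideal.span {eis a b}), Ideal.map_span, Set.image_singleton]
    exact congrArg (fun z => Ideal.absNorm (Ideal.span {z})) (conjO_eis a b).symm
  have h2 : eis a b * eis (a - b) (-b) = ((normForm a b).natAbs : 𝓞 k) := by
    have : ((normForm a b).natAbs : 𝓞 k) = (((normForm a b).natAbs : ℤ) : 𝓞 k) := by simp
    rw [this, Int.natAbs_of_nonneg (normForm_nonneg a b), eis_mul]
    simp only [eis, normForm]; push_cast; ring
  have h3 : Ideal.absNorm (Ideal.span {eis a b}) ^ 2 = (normForm a b).natAbs ^ 2 := by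
    have h := Ideal.absNorm_span_natCast (S := 𝓞 k) (normForm a b).natAbs
    rw [finrank_int, ← h2, ← Ideal.span_singleton_mul_span_singleton, map_mul, h1] at h
    rw [sq, h]
  rw [(Nat.pow_left_injective (n := 2) (by norm_num)) h3]
  exact Int.natAbs_of_nonneg (normForm_nonneg a b)

/-! ### The cubic residue symbol -/

section Symbol

variable {P : Ideal (𝓞 k)}

theorem quotient_mk_omegaO_isPrimitiveRoot (h3 : (3 : 𝓞 k) ∉ P) :
    IsPrimitiveRoot (Ideal.Quotient.mk P omegaO) 3 := by
  have hcube : (Ideal.Quotient.mk P omegaO) ^ 3 = 1 := by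
    rw [← map_pow, omegaO_cube, map_one]
  refine IsPrimitiveRoot.iff_orderOf.2 ?_
  refine orderOf_eq_prime hcube fun h => h3 ?_
  rw [← map_one (Ideal.Quotient.mk P), Ideal.Quotient.mk_eq_mk_iff_sub_mem] at h
  -- If `ω ≡ 1` modulo `P`, this factorization would put `3` in `P`.
  have : (3 : 𝓞 k) = (omegaO - 1) * (-omegaO - 2) := by
    linear_combination omegaO_sq_add
  rw [this]
  exact P.mul_mem_right _ h

theorem finite_quotient (h0 : P ≠ ⊥) : Finite (𝓞 k ⧸ P) :=
  Ideal.finiteQuotientOfFreeOfNeBot P h0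

/-- The class of `ω` has order `3` in the multiplicative group of the residue field, so `3 ∣ NP -
1`. -/
theorem absNorm_mod_three (hP : P.IsPrime) (h0 : P ≠ ⊥) (h3 : (3 : 𝓞 k) ∉ P) :
    Ideal.absNorm P % 3 = 1 := by
  have : P.IsMaximal := hP.isMaximal h0
  let := Ideal.Quotient.field P
  have := finite_quotient h0
  let := Fintype.ofFinite (𝓞 k ⧸ P)
  have hprim := quotient_mk_omegaO_isPrimitiveRoot h3
  have hne : Ideal.Quotient.mk P omegaO ≠ 0 := hprim.ne_zero (by norm_num)
  have h1 := FiniteField.pow_card_sub_one_eq_one _ hne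
  have hd := hprim.dvd_of_pow_eq_one _ h1
  rw [← Nat.card_eq_fintype_card] at hd
  have hc : Ideal.absNorm P = Nat.card (𝓞 k ⧸ P) := rfl
  have hpos : 0 < Nat.card (𝓞 k ⧸ P) := Nat.card_pos
  omega

theorem exists_pow_sub_mem (hP : P.IsPrime) (h0 : P ≠ ⊥) (h3 : (3 : 𝓞 k) ∉ P)
    {z : 𝓞 k} (hz : z ∉ P) :
    ∃ j < 3, z ^ ((Ideal.absNorm P - 1) / 3) - omegaO ^ j ∈ P := by
  have : P.IsMaximal := hP.isMaximal h0
  let := Ideal.Quotient.field P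
  have := finite_quotient h0
  let := Fintype.ofFinite (𝓞 k ⧸ P)
  have hne : Ideal.Quotient.mk P z ≠ 0 := fun h => hz (Ideal.Quotient.eq_zero_iff_mem.1 h)
  have h1 := FiniteField.pow_card_sub_one_eq_one _ hne
  rw [← Nat.card_eq_fintype_card] at h1
  have hc : Ideal.absNorm P = Nat.card (𝓞 k ⧸ P) := rfl
  have hm := absNorm_mod_three hP h0 h3
  have he : Nat.card (𝓞 k ⧸ P) - 1 = (Ideal.absNorm P - 1) / 3 * 3 := by omega
  rw [he, pow_mul] at h1
  obtain ⟨j, hj, h⟩ := (quotient_mk_omegaO_isPrimitiveRoot h3).eq_pow_of_pow_eq_one h1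
  refine ⟨j, hj, ?_⟩
  rw [← Ideal.Quotient.mk_eq_mk_iff_sub_mem, map_pow, map_pow, h]

/-- The powers of `ω` stay distinct modulo `P`, so at most one branch of the definition can apply.
Allowing `j ≥ 3` lets exponents be added and doubled in the proofs of multiplicativity and
conjugation. -/
theorem cubicSymbol_eq_of_mem (h3 : (3 : 𝓞 k) ∉ P) {z : 𝓞 k} (hz : z ∉ P) {j : ℕ}
    (h : z ^ ((Ideal.absNorm P - 1) / 3) - omegaO ^ j ∈ P) : cubicSymbol P z = omega ^ j := by
  have hinj : ∀ i < 3, z ^ ((Ideal.absNorm P - 1) / 3) - omegaO ^ i ∈ P → i = j % 3 := by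
    intro i hi hmem
    rw [omegaO_pow_mod, ← Ideal.Quotient.mk_eq_mk_iff_sub_mem] at h
    rw [← Ideal.Quotient.mk_eq_mk_iff_sub_mem, h, map_pow, map_pow] at hmem
    exact ((quotient_mk_omegaO_isPrimitiveRoot h3).pow_inj (Nat.mod_lt _ (by norm_num)) hi
      hmem).symm
  rw [omegaO_pow_mod] at h
  rw [omega_pow_mod]
  have hlt : j % 3 < 3 := Nat.mod_lt _ (by norm_num)
  have i0 := hinj 0 (by norm_num)
  have i1 := hinj 1 (by norm_num)
  have i2 := hinj 2 (by norm_num)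
  rw [pow_zero] at i0
  rw [pow_one] at i1
  unfold cubicSymbol
  rw [if_neg hz]
  generalize j % 3 = r at *
  interval_cases r
  · rw [pow_zero] at h
    rw [if_pos h, pow_zero]
  · rw [pow_one] at h
    rw [if_neg (fun h => by simpa using i0 h), if_pos h, pow_one]
  · rw [if_neg (fun h => by simpa using i0 h), if_neg (fun h => by simpa using i1 h), if_pos h]

theorem cubicSymbol_of_mem {z : 𝓞 k} (hz : z ∈ P) : cubicSymbol P z = 0 := if_pos hz

theorem cubicSymbol_mul (hP : P.IsPrime) (h0 : P ≠ ⊥) (h3 : (3 : 𝓞 k) ∉ P) (z w : 𝓞 k) :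
    cubicSymbol P (z * w) = cubicSymbol P z * cubicSymbol P w := by
  by_cases hz : z ∈ P
  · rw [cubicSymbol_of_mem hz, cubicSymbol_of_mem (P.mul_mem_right _ hz), zero_mul]
  by_cases hw : w ∈ P
  · rw [cubicSymbol_of_mem hw, cubicSymbol_of_mem (P.mul_mem_left _ hw), mul_zero]
  obtain ⟨i, -, hi⟩ := exists_pow_sub_mem hP h0 h3 hz
  obtain ⟨j, -, hj⟩ := exists_pow_sub_mem hP h0 h3 hw
  have hzw : z * w ∉ P := fun h => (hP.mem_or_mem h).elim hz hw
  rw [cubicSymbol_eq_of_mem h3 hz hi, cubicSymbol_eq_of_mem h3 hw hj, ← pow_add]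
  refine cubicSymbol_eq_of_mem h3 hzw ?_
  rw [← Ideal.Quotient.mk_eq_mk_iff_sub_mem] at hi hj ⊢
  rw [mul_pow, pow_add, map_mul, map_mul, hi, hj]

theorem cubicSymbol_congr {z w : 𝓞 k} (h : z - w ∈ P) : cubicSymbol P z = cubicSymbol P w := by
  have e : ∀ u, z ^ ((Ideal.absNorm P - 1) / 3) - u ∈ P ↔
      w ^ ((Ideal.absNorm P - 1) / 3) - u ∈ P := by
    intro u
    rw [← Ideal.Quotient.mk_eq_mk_iff_sub_mem] at h
    rw [← Ideal.Quotient.mk_eq_mk_iff_sub_mem, ← Ideal.Quotient.mk_eq_mk_iff_sub_mem, map_pow,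
      map_pow, h]
  have hm : z ∈ P ↔ w ∈ P := by
    rw [← Ideal.Quotient.eq_zero_iff_mem, ← Ideal.Quotient.eq_zero_iff_mem,
      Ideal.Quotient.mk_eq_mk_iff_sub_mem z w |>.2 h]
  classical
  exact if_congr hm rfl (if_congr (e _) rfl (if_congr (e _) rfl (if_congr (e _) rfl rfl)))

theorem cubicSymbol_cube (hP : P.IsPrime) (h0 : P ≠ ⊥) (h3 : (3 : 𝓞 k) ∉ P) {z : 𝓞 k}
    (hz : z ∉ P) : cubicSymbol P z ^ 3 = 1 := by
  obtain ⟨i, -, hi⟩ := exists_pow_sub_mem hP h0 h3 hz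
  rw [cubicSymbol_eq_of_mem h3 hz hi, ← pow_mul, mul_comm, pow_mul, omega_cube, one_pow]

theorem cubicSymbol_one (hP : P.IsPrime) (h3 : (3 : 𝓞 k) ∉ P) :
    cubicSymbol P 1 = 1 := by
  have := cubicSymbol_eq_of_mem (z := 1) (j := 0) h3 ((Ideal.ne_top_iff_one P).1 hP.ne_top) (by simp)
  simpa using this

theorem cubicSymbol_omegaO (hP : P.IsPrime) (h3 : (3 : 𝓞 k) ∉ P) :
    cubicSymbol P omegaO = omega ^ ((Ideal.absNorm P - 1) / 3) := by
  refine cubicSymbol_eq_of_mem h3 (fun h => hP.ne_top ?_) (by simp)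
  rw [Ideal.eq_top_iff_one, ← omegaO_cube, pow_succ]
  exact P.mul_mem_left _ h

theorem cubicSymbol_conj (hP : P.IsPrime) (h0 : P ≠ ⊥) (h3 : (3 : 𝓞 k) ∉ P) (z : 𝓞 k) :
    cubicSymbol (P.map conjO) (conjO z) = conj (cubicSymbol P z) := by
  have hmem : ∀ w, conjO w ∈ P.map conjO ↔ w ∈ P := fun w => by
    rw [Ideal.mem_map_of_equiv]
    exact ⟨fun ⟨x, hx, h⟩ => conjO.injective h ▸ hx, fun h => ⟨w, h, rfl⟩⟩
  by_cases hz : z ∈ P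
  · rw [cubicSymbol_of_mem hz, cubicSymbol_of_mem ((hmem z).2 hz), map_zero]
  obtain ⟨i, -, hi⟩ := exists_pow_sub_mem hP h0 h3 hz
  rw [cubicSymbol_eq_of_mem h3 hz hi, map_pow, conj_omega, ← pow_mul]
  refine cubicSymbol_eq_of_mem ?_ (fun h => hz ((hmem z).1 h)) ?_
  · rwa [show (3 : 𝓞 k) = conjO 3 from (map_ofNat conjO 3).symm, hmem]
  · rw [absNorm_map_conjO, pow_mul, ← conjO_omegaO, ← map_pow, ← map_pow, ← map_sub, hmem]
    exact hi

end Symbol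

/-! ### The product of cubic residue symbols -/

open UniqueFactorizationMonoid

section Product

variable {n : ℕ}

theorem span_natCast_ne_bot (hpos : 0 < n) : Ideal.span {(n : 𝓞 k)} ≠ ⊥ := by
  rw [Ne, Ideal.span_singleton_eq_bot]
  exact_mod_cast hpos.ne'

theorem three_notMem_of_natCast_mem (h3 : Nat.Coprime n 3) {P : Ideal (𝓞 k)} (hP : P.IsPrime)
    (hn : (n : 𝓞 k) ∈ P) : (3 : 𝓞 k) ∉ P := by
  intro h
  apply hP.ne_top
  rw [Ideal.eq_top_iff_one]
  have hb := Nat.isCoprime_iff_coprime.2 h3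
  obtain ⟨u, v, huv⟩ := hb
  have e := congrArg (Int.cast : ℤ → 𝓞 k) huv
  push_cast at e
  rw [← e]
  exact P.add_mem (P.mul_mem_left _ hn) (P.mul_mem_left _ h)

theorem mem_normalizedFactors_span_iff (hpos : 0 < n) {P : Ideal (𝓞 k)} :
    P ∈ normalizedFactors (Ideal.span {(n : 𝓞 k)}) ↔ P.IsPrime ∧ (n : 𝓞 k) ∈ P := by
  rw [Ideal.mem_normalizedFactors_iff (span_natCast_ne_bot hpos), Ideal.span_singleton_le_iff_mem]

theorem isPrime_of_mem_factors (hpos : 0 < n) (h3 : Nat.Coprime n 3) {P : Ideal (𝓞 k)}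
    (h : P ∈ normalizedFactors (Ideal.span {(n : 𝓞 k)})) :
    P.IsPrime ∧ P ≠ ⊥ ∧ (3 : 𝓞 k) ∉ P := by
  obtain ⟨hP, hn⟩ := (mem_normalizedFactors_span_iff hpos).1 h
  refine ⟨hP, ?_, three_notMem_of_natCast_mem h3 hP hn⟩
  rintro rfl
  rw [Ideal.mem_bot] at hn
  exact hpos.ne' (by exact_mod_cast hn)

theorem cubicProd_mul (hpos : 0 < n) (h3 : Nat.Coprime n 3) (z w : 𝓞 k) :
    cubicProd n (z * w) = cubicProd n z * cubicProd n w := by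
  unfold cubicProd
  rw [← Multiset.prod_map_mul]
  refine congrArg _ (Multiset.map_congr rfl fun P hP => ?_)
  obtain ⟨h1, h2, h4⟩ := isPrime_of_mem_factors hpos h3 hP
  exact cubicSymbol_mul h1 h2 h4 z w

theorem cubicProd_one (hpos : 0 < n) (h3 : Nat.Coprime n 3) : cubicProd n 1 = 1 := by
  unfold cubicProd
  refine Multiset.prod_eq_one fun x hx => ?_
  obtain ⟨P, hP, rfl⟩ := Multiset.mem_map.1 hx
  obtain ⟨h1, h2, h4⟩ := isPrime_of_mem_factors hpos h3 hP
  exact cubicSymbol_one h1 h4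

theorem cubicProd_congr (hpos : 0 < n) {z w : 𝓞 k} (h : z - w ∈ Ideal.span {(n : 𝓞 k)}) :
    cubicProd n z = cubicProd n w := by
  unfold cubicProd
  refine congrArg _ (Multiset.map_congr rfl fun P hP => cubicSymbol_congr ?_)
  have := ((mem_normalizedFactors_span_iff hpos).1 hP).2
  exact ((Ideal.span_singleton_le_iff_mem _).2 this : _ ≤ P) h

theorem cubicProd_cube (hpos : 0 < n) (h3 : Nat.Coprime n 3) {z : 𝓞 k}
    (hz : ∀ P ∈ normalizedFactors (Ideal.span {(n : 𝓞 k)}), z ∉ P) : cubicProd n z ^ 3 = 1 := by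
  unfold cubicProd
  rw [← Multiset.prod_map_pow]
  refine Multiset.prod_eq_one fun x hx => ?_
  obtain ⟨P, hP, rfl⟩ := Multiset.mem_map.1 hx
  obtain ⟨h1, h2, h4⟩ := isPrime_of_mem_factors hpos h3 hP
  exact cubicSymbol_cube h1 h2 h4 (hz P hP)

theorem cubicProd_eq_zero {z : 𝓞 k} {P : Ideal (𝓞 k)}
    (hP : P ∈ normalizedFactors (Ideal.span {(n : 𝓞 k)})) (hz : z ∈ P) : cubicProd n z = 0 :=
  Multiset.prod_eq_zero (Multiset.mem_map.2 ⟨P, hP, cubicSymbol_of_mem hz⟩)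

/-- As `n` is rational, conjugation fixes `(n)`, so by unique factorization it permutes the prime
factors with their multiplicities. -/
theorem normalizedFactors_map_conjO (hpos : 0 < n) :
    (normalizedFactors (Ideal.span {(n : 𝓞 k)})).map (Ideal.map conjO) =
      normalizedFactors (Ideal.span {(n : 𝓞 k)}) := by
  have h : ((normalizedFactors (Ideal.span {(n : 𝓞 k)})).map (Ideal.map conjO)).prod =
      Ideal.span {(n : 𝓞 k)} := by
    have e : Ideal.map conjO (Ideal.span {(n : 𝓞 k)}) = Ideal.span {(n : 𝓞 k)} := by
      rw [Ideal.map_span, Set.image_singleton]; simp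
    conv_rhs => rw [← e, ← Ideal.prod_normalizedFactors_eq_self (span_natCast_ne_bot hpos)]
    exact ((Ideal.mapHom conjO.toRingHom).map_multiset_prod _).symm
  conv_rhs => rw [← h]
  refine (normalizedFactors_prod_of_prime fun Q hQ => ?_).symm
  obtain ⟨P, hP, rfl⟩ := Multiset.mem_map.1 hQ
  obtain ⟨hprime, hn⟩ := (mem_normalizedFactors_span_iff hpos).1 hP
  refine (Ideal.prime_iff_isPrime fun h => ?_).2 (Ideal.map_isPrime_of_equiv conjO)
  have : conjO (n : 𝓞 k) ∈ P.map conjO := Ideal.mem_map_of_mem _ hn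
  rw [h, Ideal.mem_bot, map_natCast] at this
  exact hpos.ne' (by exact_mod_cast this)

theorem cubicProd_conj (hpos : 0 < n) (h3 : Nat.Coprime n 3) (z : 𝓞 k) :
    cubicProd n (conjO z) = conj (cubicProd n z) := by
  unfold cubicProd
  conv_lhs => rw [← normalizedFactors_map_conjO hpos]
  rw [map_multiset_prod, Multiset.map_map, Multiset.map_map]
  refine congrArg _ (Multiset.map_congr rfl fun P hP => ?_)
  obtain ⟨h1, h2, h4⟩ := isPrime_of_mem_factors hpos h3 hP
  exact cubicSymbol_conj h1 h2 h4 z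

/-- On integers `m ≡ 1` modulo `3`, the map `m ↦ (m - 1)/3` modulo `3` turns products into sums: the
cross term in `(3a + 1)(3b + 1)` is divisible by `9`. -/
theorem prod_mod_three_and_prod_omega_pow (s : Multiset ℕ) (h : ∀ m ∈ s, m % 3 = 1) :
    s.prod % 3 = 1 ∧ (s.map fun m => omega ^ ((m - 1) / 3)).prod = omega ^ ((s.prod - 1) / 3) := by
  induction s using Multiset.induction_on with
  | empty => simp
  | cons m s ih =>
    obtain ⟨i1, i2⟩ := ih fun x hx => h x (Multiset.mem_cons_of_mem hx)
    have hm := h m (Multiset.mem_cons_self _ _)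
    rw [Multiset.prod_cons, Multiset.map_cons, Multiset.prod_cons, i2]
    obtain ⟨a, ha⟩ : ∃ a, m = 3 * a + 1 := ⟨m / 3, by omega⟩
    obtain ⟨b, hb⟩ : ∃ b, s.prod = 3 * b + 1 := ⟨s.prod / 3, by omega⟩
    have hmul : m * s.prod = 3 * (3 * (a * b) + a + b) + 1 := by rw [ha, hb]; ring
    refine ⟨by omega, ?_⟩
    rw [show (m - 1) / 3 = a by omega, show (s.prod - 1) / 3 = b by omega,
      show (m * s.prod - 1) / 3 = 3 * (a * b) + a + b by omega, pow_add, pow_add, pow_mul omega 3,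
      omega_cube, one_pow, one_mul]

theorem cubicProd_omegaO (hpos : 0 < n) (h3 : Nat.Coprime n 3) :
    cubicProd n omegaO = omega ^ ((n ^ 2 - 1) / 3) := by
  set s := (normalizedFactors (Ideal.span {(n : 𝓞 k)})).map Ideal.absNorm with hs
  have hprod : s.prod = n ^ 2 := by
    rw [hs, ← map_multiset_prod, Ideal.prod_normalizedFactors_eq_self (span_natCast_ne_bot hpos),
      Ideal.absNorm_span_natCast, finrank_int]
  rw [← hprod, ← (prod_mod_three_and_prod_omega_pow s ?_).2, hs, Multiset.map_map]
  · unfold cubicProd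
    refine congrArg _ (Multiset.map_congr rfl fun P hP => ?_)
    obtain ⟨h1, h2, h4⟩ := isPrime_of_mem_factors hpos h3 hP
    exact cubicSymbol_omegaO h1 h4
  · intro m hm
    obtain ⟨P, hP, rfl⟩ := Multiset.mem_map.1 hm
    obtain ⟨h1, h2, h4⟩ := isPrime_of_mem_factors hpos h3 hP
    exact absNorm_mod_three h1 h2 h4

/-- For `n` prime to `3`, `n² ≡ 1` modulo `9` only when `n ≡ ±1` modulo `9`. Otherwise `χ(ω)` is `ω`
or `ω²`, and both have real part `-1/2`. -/
theorem cubicProd_omegaO_re (hpos : 0 < n) (h3 : Nat.Coprime n 3)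
    (h1 : ¬ (n : ℤ) ≡ 1 [ZMOD 9]) (h2 : ¬ (n : ℤ) ≡ -1 [ZMOD 9]) :
    (cubicProd n omegaO).re = -1 / 2 := by
  rw [cubicProd_omegaO hpos h3, omega_pow_mod]
  have h3' : n % 3 ≠ 0 := by
    intro h
    have := Nat.eq_one_of_dvd_coprimes h3 (Nat.dvd_of_mod_eq_zero h) dvd_rfl
    omega
  have key : ((n ^ 2 - 1) / 3) % 3 = 1 ∨ ((n ^ 2 - 1) / 3) % 3 = 2 := by
    unfold Int.ModEq at h1 h2
    have hr : n = 9 * (n / 9) + n % 9 := by omega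
    have hsq : n ^ 2 = 9 * (9 * (n / 9) ^ 2 + 2 * (n / 9) * (n % 9)) + (n % 9) ^ 2 := by
      conv_lhs => rw [hr]
      ring
    rw [hsq]
    generalize 9 * (n / 9) ^ 2 + 2 * (n / 9) * (n % 9) = q
    have : n % 9 = 2 ∨ n % 9 = 4 ∨ n % 9 = 5 ∨ n % 9 = 7 := by omega
    rcases this with h | h | h | h <;> rw [h] <;> omega
  rcases key with h | h <;> rw [h]
  · rw [pow_one, omega_re]
  · exact omega_sq_re

end Product

/-! ### The character -/

section Character

variable {n : ℕ}

theorem notMem_of_isUnit_mk_modulus {z : 𝓞 k} (h : IsUnit (Ideal.Quotient.mk (modulus n) z))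
    {P : Ideal (𝓞 k)} (hP : P.IsPrime) (hn : ((3 * n : ℕ) : 𝓞 k) ∈ P) : z ∉ P := by
  intro hz
  obtain ⟨w, hw⟩ := h.exists_right_inv
  obtain ⟨w, rfl⟩ := Ideal.Quotient.mk_surjective w
  rw [← map_mul, ← map_one (Ideal.Quotient.mk (modulus n)),
    Ideal.Quotient.mk_eq_mk_iff_sub_mem] at hw
  have h1 : z * w - 1 ∈ P := ((Ideal.span_singleton_le_iff_mem _).2 hn : _ ≤ P) hw
  have : (1 : 𝓞 k) ∈ P := by
    have := P.sub_mem (P.mul_mem_right w hz) h1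
    simpa using this
  exact hP.ne_top ((Ideal.eq_top_iff_one P).2 this)

theorem notMem_factors_of_isUnit (hpos : 0 < n) {z : 𝓞 k}
    (h : IsUnit (Ideal.Quotient.mk (modulus n) z)) :
    ∀ P ∈ normalizedFactors (Ideal.span {(n : 𝓞 k)}), z ∉ P := by
  intro P hP
  obtain ⟨hprime, hn⟩ := (mem_normalizedFactors_span_iff hpos).1 hP
  refine notMem_of_isUnit_mk_modulus h hprime ?_
  push_cast
  exact P.mul_mem_left _ hn

/-- A non-unit would lie in a prime ideal containing `3n`. That prime cannot contain `3`, because `z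
≡ 1` modulo `3`, so it divides `n`. -/
theorem isUnit_mk_modulus (hpos : 0 < n) {z : 𝓞 k} (h1 : z - 1 ∈ Ideal.span {(3 : 𝓞 k)})
    (h : ∀ P ∈ normalizedFactors (Ideal.span {(n : 𝓞 k)}), z ∉ P) :
    IsUnit (Ideal.Quotient.mk (modulus n) z) := by
  by_contra hu
  obtain ⟨M, hM, hzM⟩ := exists_max_ideal_of_mem_nonunits hu
  set P := M.comap (Ideal.Quotient.mk (modulus n))
  have hP : P.IsPrime := Ideal.comap_isPrime _ _
  have hz : z ∈ P := hzM
  have hmod : ((3 * n : ℕ) : 𝓞 k) ∈ P := by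
    rw [Ideal.mem_comap, Ideal.Quotient.eq_zero_iff_mem.2 (Ideal.mem_span_singleton_self _)]
    exact M.zero_mem
  push_cast at hmod
  rcases hP.mem_or_mem hmod with h3 | hn
  · have h2 : z - 1 ∈ P := ((Ideal.span_singleton_le_iff_mem _).2 h3 : _ ≤ P) h1
    have := P.sub_mem hz h2
    rw [sub_sub_cancel] at this
    exact hP.ne_top ((Ideal.eq_top_iff_one P).2 this)
  · exact h P ((mem_normalizedFactors_span_iff hpos).2 ⟨hP, hn⟩) hz

theorem cubicProd_congr_modulus (hpos : 0 < n) {z w : 𝓞 k}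
    (h : Ideal.Quotient.mk (modulus n) z = Ideal.Quotient.mk (modulus n) w) :
    cubicProd n z = cubicProd n w := by
  refine cubicProd_congr hpos ?_
  rw [Ideal.Quotient.mk_eq_mk_iff_sub_mem] at h
  refine (Ideal.span_singleton_le_span_singleton.2 ?_ : modulus n ≤ _) h
  push_cast
  exact Dvd.intro_left _ rfl

open Classical in
/-- The character `χ` modulo `3n` given by the product of cubic residue symbols. -/
def cubicChar (hpos : 0 < n) (h3 : Nat.Coprime n 3) : MulChar (𝓞 k ⧸ modulus n) ℂ where
  -- The symbol product depends only on the class, so the choice of representative is harmless. The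
  -- value `0` must be imposed: the product need not vanish at elements sharing only the prime above
  -- `3` with the modulus.
  toFun q := if IsUnit q then cubicProd n (Quotient.out q) else 0
  map_one' := by
    rw [if_pos isUnit_one, ← cubicProd_one hpos h3]
    refine cubicProd_congr_modulus hpos ?_
    rw [map_one]
    exact Quotient.out_eq _
  map_mul' x y := by
    by_cases hx : IsUnit x
    · by_cases hy : IsUnit y
      · rw [if_pos hx, if_pos hy, if_pos (hx.mul hy), ← cubicProd_mul hpos h3]
        refine cubicProd_congr_modulus hpos ?_
        rw [map_mul]
        refine (Quotient.out_eq _).trans (congrArg₂ _ ?_ ?_)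
        · exact (Quotient.out_eq _).symm
        · exact (Quotient.out_eq _).symm
      · rw [if_neg hy, if_neg fun h => hy (isUnit_of_mul_isUnit_right h), mul_zero]
    · rw [if_neg hx, if_neg fun h => hx (isUnit_of_mul_isUnit_left h), zero_mul]
  map_nonunit' x hx := if_neg hx

theorem cubicChar_apply (hpos : 0 < n) (h3 : Nat.Coprime n 3) {z : 𝓞 k}
    (hz : IsUnit (Ideal.Quotient.mk (modulus n) z)) :
    cubicChar hpos h3 (Ideal.Quotient.mk (modulus n) z) = cubicProd n z := by
  refine (if_pos hz).trans (cubicProd_congr_modulus hpos ?_)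
  exact Quotient.out_eq _

/-- The value of the character at `a + bω`. -/
def charVal (hpos : 0 < n) (h3 : Nat.Coprime n 3) (a b : ℤ) : ℂ :=
  cubicChar hpos h3 (Ideal.Quotient.mk (modulus n) (eis a b))

/-- No unit hypothesis is needed: a primary element that is not a unit modulo `3n` lies in a prime
factor of `n`, where both sides vanish. -/
theorem charVal_eq_cubicProd (hpos : 0 < n) (h3 : Nat.Coprime n 3) {a b : ℤ} (h : Primary a b) :
    charVal hpos h3 a b = cubicProd n (eis a b) := by
  by_cases hu : ∀ P ∈ normalizedFactors (Ideal.span {(n : 𝓞 k)}), eis a b ∉ P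
  · exact cubicChar_apply hpos h3 (isUnit_mk_modulus hpos ((eis_sub_one_mem_iff a b).2 h) hu)
  · have hnu : ¬ IsUnit (Ideal.Quotient.mk (modulus n) (eis a b)) :=
      fun h => hu (notMem_factors_of_isUnit hpos h)
    push Not at hu
    obtain ⟨P, hP, hz⟩ := hu
    rw [charVal, MulChar.map_nonunit _ hnu, cubicProd_eq_zero hP hz]

theorem norm_charVal_le_one (hpos : 0 < n) (h3 : Nat.Coprime n 3) (a b : ℤ) :
    ‖charVal hpos h3 a b‖ ≤ 1 := by
  by_cases hu : IsUnit (Ideal.Quotient.mk (modulus n) (eis a b))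
  · rw [charVal, cubicChar_apply hpos h3 hu]
    have := cubicProd_cube hpos h3 (notMem_factors_of_isUnit hpos hu)
    exact (Complex.norm_eq_one_of_pow_eq_one this (by norm_num)).le
  · rw [charVal, MulChar.map_nonunit _ hu]; simp

theorem isUnit_mk_intCast (h : IsCoprime e ((3 * n : ℕ) : ℤ)) :
    IsUnit (Ideal.Quotient.mk (modulus n) (e : 𝓞 k)) := by
  obtain ⟨u, v, huv⟩ := h
  refine IsUnit.of_mul_eq_one (Ideal.Quotient.mk (modulus n) (u : 𝓞 k)) ?_
  rw [← map_mul, ← map_one (Ideal.Quotient.mk (modulus n)),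
    Ideal.Quotient.mk_eq_mk_iff_sub_mem, Ideal.mem_span_singleton]
  refine ⟨-v, ?_⟩
  have := congrArg (Int.cast : ℤ → 𝓞 k) huv
  push_cast at this ⊢
  linear_combination this

/-- Conjugation invariance makes the value real, and the only real cube root of unity is `1`. -/
theorem cubicProd_intCast (hpos : 0 < n) (h3 : Nat.Coprime n 3) {e : ℤ}
    (h : IsCoprime e ((3 * n : ℕ) : ℤ)) : cubicProd n (e : 𝓞 k) = 1 := by
  have h1 := cubicProd_cube hpos h3 (notMem_factors_of_isUnit hpos (isUnit_mk_intCast h))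
  have h2 := cubicProd_conj hpos h3 (e : 𝓞 k)
  rw [map_intCast] at h2
  obtain ⟨r, hr⟩ := Complex.conj_eq_iff_real.1 h2.symm
  rw [hr] at h1 ⊢
  have h4 : r ^ 3 = 1 := by exact_mod_cast h1
  have : r = 1 := by
    nlinarith [sq_nonneg (r + 1 / 2), show (r - 1) * (r ^ 2 + r + 1) = 0 by linear_combination h4]
  rw [this, Complex.ofReal_one]

theorem charVal_mul_int (hpos : 0 < n) (h3 : Nat.Coprime n 3) (e a b : ℤ) :
    charVal hpos h3 (e * a) (e * b) =
      (if IsCoprime e ((3 * n : ℕ) : ℤ) then 1 else 0) * charVal hpos h3 a b := by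
  have he : eis (e * a) (e * b) = (e : 𝓞 k) * eis a b := by simp only [eis]; push_cast; ring
  rw [charVal, he, map_mul, map_mul]
  refine congrArg (· * _) ?_
  split_ifs with h
  · rw [cubicChar_apply hpos h3 (isUnit_mk_intCast h), cubicProd_intCast hpos h3 h]
  · refine MulChar.map_nonunit _ fun hu => h ?_
    obtain ⟨w, hw⟩ := hu.exists_right_inv
    obtain ⟨w, rfl⟩ := Ideal.Quotient.mk_surjective w
    rw [← map_mul, ← map_one (Ideal.Quotient.mk (modulus n)),
      Ideal.Quotient.mk_eq_mk_iff_sub_mem, Ideal.mem_span_singleton] at hw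
    obtain ⟨v, hv⟩ := hw
    obtain ⟨x, y, rfl⟩ := exists_eq_eis w
    obtain ⟨p, q, rfl⟩ := exists_eq_eis v
    have : eis (e * x) (e * y) = eis (1 + (3 * n : ℕ) * p) ((3 * n : ℕ) * q) := by
      simp only [eis] at hv ⊢
      push_cast at hv ⊢
      linear_combination hv
    exact ⟨x, -p, by linear_combination (eis_injective this).1⟩

theorem cubicProd_neg (hpos : 0 < n) (h3 : Nat.Coprime n 3) (z : 𝓞 k) :
    cubicProd n (-z) = cubicProd n z := by
  have := cubicProd_intCast hpos h3 (e := -1) isCoprime_one_left.neg_left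
  rw [neg_eq_neg_one_mul, cubicProd_mul hpos h3, show (-1 : 𝓞 k) = ((-1 : ℤ) : 𝓞 k) by simp, this,
    one_mul]

end Character

/-! ### Summation over the primary elements of `ℤ[ω]` -/

/-- The primary elements `a + bω`, by their coordinates. -/
abbrev PrimaryPairs : Type := {p : ℤ × ℤ // Primary p.1 p.2}

/-- The primary elements `a + bω` that are not divisible by a rational integer other than `±1`. -/
abbrev PrimitivePairs : Type := {p : ℤ × ℤ // Primary p.1 p.2 ∧ IsCoprime p.1 p.2}

/-- `N(a + bω)^{-s}`. -/
def normPow (s : ℂ) (p : ℤ × ℤ) : ℂ := (normForm p.1 p.2 : ℂ) ^ (-s)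

theorem norm_normPow (s : ℂ) {p : ℤ × ℤ} (h : p ≠ 0) :
    ‖normPow s p‖ = (normForm p.1 p.2 : ℝ) ^ (-s.re) := by
  have hp : (0 : ℝ) < normForm p.1 p.2 := by exact_mod_cast normForm_pos (a := p.1) (b := p.2) h
  rw [normPow, ← Complex.neg_re, ← Complex.norm_cpow_eq_rpow_re_of_pos hp]
  simp

/-- Comparison with the sup norm on `ℤ²`, whose powers are summable for exponents beyond `2`. -/
theorem summable_normForm_rpow {σ : ℝ} (hσ : 1 < σ) :
    Summable fun p : ℤ × ℤ => (normForm p.1 p.2 : ℝ) ^ (-σ) := by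
  have h := EisensteinSeries.summable_one_div_norm_rpow (k := 2 * σ) (by linarith)
  rw [← (finTwoArrowEquiv ℤ).symm.summable_iff] at h
  refine Summable.of_nonneg_of_le (fun p => Real.rpow_nonneg
    (by exact_mod_cast normForm_nonneg p.1 p.2) _) (fun p => ?_) (h.mul_left (2 ^ σ))
  rcases eq_or_ne p 0 with rfl | hp
  · have : normForm 0 0 = 0 := rfl
    simp only [Prod.fst_zero, Prod.snd_zero, this, Int.cast_zero]
    rw [Real.zero_rpow (by linarith)]
    exact mul_nonneg (by positivity) (Real.rpow_nonneg (norm_nonneg _) _)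
  have hpos : 0 < normForm p.1 p.2 := normForm_pos hp
  set x : Fin 2 → ℤ := (finTwoArrowEquiv ℤ).symm p with hx
  have hx0 : x ≠ 0 := by
    intro h0
    apply hp
    have e0 := congrFun h0 0
    have e1 := congrFun h0 1
    exact Prod.ext e0 e1
  have hxpos : 0 < ‖x‖ := norm_pos_iff.2 hx0
  have hle : ‖x‖ ^ 2 ≤ 2 * (normForm p.1 p.2 : ℝ) := by
    have hi : ∀ i, ‖x i‖ ≤ Real.sqrt (2 * (normForm p.1 p.2 : ℝ)) := by
      intro i
      refine Real.le_sqrt_of_sq_le ?_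
      rw [Int.norm_eq_abs, sq_abs]
      -- Completing the square gives `3 xᵢ² ≤ 4N`, and `4/3 ≤ 2`.
      have : x i ^ 2 ≤ 2 * normForm p.1 p.2 := by
        fin_cases i
        · change p.1 ^ 2 ≤ _
          nlinarith [four_mul_normForm' p.1 p.2, sq_nonneg (2 * p.2 - p.1), sq_nonneg p.1]
        · change p.2 ^ 2 ≤ _
          nlinarith [four_mul_normForm p.1 p.2, sq_nonneg (2 * p.1 - p.2), sq_nonneg p.2]
      exact_mod_cast this
    have := (pi_norm_le_iff_of_nonneg (Real.sqrt_nonneg _)).2 hi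
    calc ‖x‖ ^ 2 ≤ Real.sqrt (2 * (normForm p.1 p.2 : ℝ)) ^ 2 := by gcongr
      _ = _ := Real.sq_sqrt (by positivity)
  have hN : (0 : ℝ) < normForm p.1 p.2 := by exact_mod_cast hpos
  change _ ≤ 2 ^ σ * ‖x‖ ^ (-(2 * σ))
  have e1 : ‖x‖ ^ (-(2 * σ)) = (‖x‖ ^ 2) ^ (-σ) := by
    rw [← Real.rpow_natCast, ← Real.rpow_mul hxpos.le]; congr 1; push_cast; ring
  have e2 : (2 : ℝ) ^ σ = (2⁻¹ : ℝ) ^ (-σ) := by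
    rw [Real.rpow_neg (by norm_num), Real.inv_rpow (by norm_num), inv_inv]
  rw [e1, e2, ← Real.mul_rpow (by norm_num) (by positivity)]
  exact Real.rpow_le_rpow_of_nonpos (by positivity) (by linarith) (by linarith)

theorem summable_norm_mul_normPow {s : ℂ} (hs : 1 < s.re) {ι : Type*} {φ : ι → ℤ × ℤ}
    (hφ : Function.Injective φ) (h0 : ∀ i, φ i ≠ 0) {g : ι → ℂ} {B : ℝ} (hg : ∀ i, ‖g i‖ ≤ B) :
    Summable fun i => ‖g i * normPow s (φ i)‖ := by
  refine Summable.of_nonneg_of_le (fun _ => norm_nonneg _) (fun i => ?_)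
    (((summable_normForm_rpow hs).comp_injective hφ).mul_left B)
  rw [norm_mul, norm_normPow s (h0 i)]
  exact mul_le_mul_of_nonneg_right (hg i)
    (Real.rpow_nonneg (by exact_mod_cast normForm_nonneg _ _) _)

theorem PrimaryPairs.ne_zero (p : PrimaryPairs) : p.1 ≠ 0 := p.2.ne_zero

theorem PrimitivePairs.ne_zero (p : PrimitivePairs) : p.1 ≠ 0 := p.2.1.ne_zero

/-! ### The `L`-series as a sum over primary elements -/

/-- The ideal generated by a primary element. -/
def primaryIdeal (p : PrimaryPairs) : Ideal (𝓞 k) := Ideal.span {eis p.1.1 p.1.2}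

theorem primaryIdeal_injective : Function.Injective primaryIdeal := fun p q h => by
  obtain ⟨h1, h2⟩ := span_eis_injective p.2 q.2 h
  exact Subtype.ext (Prod.ext h1 h2)

variable {n : ℕ}

theorem lTerm_eq_zero (χ : MulChar (𝓞 k ⧸ modulus n) ℂ) (s : ℂ) {I : Ideal (𝓞 k)}
    (hI : I ∉ Set.range primaryIdeal) : lTerm χ s I = 0 := by
  have h : ¬ ∃ α : 𝓞 k, I = Ideal.span {α} ∧ α - 1 ∈ Ideal.span {(3 : 𝓞 k)} := by
    rintro ⟨α, rfl, hα⟩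
    obtain ⟨a, b, rfl⟩ := exists_eq_eis α
    exact hI ⟨⟨(a, b), (eis_sub_one_mem_iff a b).1 hα⟩, rfl⟩
  rw [lTerm, idealValue, dif_neg h, zero_mul]

theorem idealValue_primaryIdeal (χ : MulChar (𝓞 k ⧸ modulus n) ℂ) (p : PrimaryPairs) :
    idealValue χ (primaryIdeal p) = χ (Ideal.Quotient.mk (modulus n) (eis p.1.1 p.1.2)) := by
  have h : ∃ α : 𝓞 k, primaryIdeal p = Ideal.span {α} ∧ α - 1 ∈ Ideal.span {(3 : 𝓞 k)} :=
    ⟨_, rfl, (eis_sub_one_mem_iff _ _).2 p.2⟩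
  rw [idealValue, dif_pos h]
  obtain ⟨h1, h2⟩ := h.choose_spec
  obtain ⟨a, b, hab⟩ := exists_eq_eis h.choose
  rw [hab] at h1 h2 ⊢
  obtain ⟨rfl, rfl⟩ := span_eis_injective p.2 ((eis_sub_one_mem_iff a b).1 h2) h1
  rfl

theorem lTerm_primaryIdeal (hpos : 0 < n) (h3 : Nat.Coprime n 3) (s : ℂ) (p : PrimaryPairs) :
    lTerm (cubicChar hpos h3) s (primaryIdeal p) = charVal hpos h3 p.1.1 p.1.2 * normPow s p.1 := by
  rw [lTerm, idealValue_primaryIdeal, normPow, ← absNorm_span_eis, Int.cast_natCast]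
  rfl

theorem summable_charVal_mul_normPow (hpos : 0 < n) (h3 : Nat.Coprime n 3) {s : ℂ}
    (hs : 1 < s.re) :
    Summable fun p : PrimaryPairs => charVal hpos h3 p.1.1 p.1.2 * normPow s p.1 :=
  (summable_norm_mul_normPow hs Subtype.val_injective PrimaryPairs.ne_zero
    (fun p => norm_charVal_le_one hpos h3 p.1.1 p.1.2)).of_norm

theorem summable_lTerm (hpos : 0 < n) (h3 : Nat.Coprime n 3) {s : ℂ} (hs : 1 < s.re) :
    Summable (lTerm (cubicChar hpos h3) s) := by
  rw [← primaryIdeal_injective.summable_iff fun I hI => lTerm_eq_zero _ s hI]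
  exact (summable_charVal_mul_normPow hpos h3 hs).congr fun p => (lTerm_primaryIdeal hpos h3 s p).symm

theorem Lk_eq_tsum_primaryPairs (hpos : 0 < n) (h3 : Nat.Coprime n 3) (s : ℂ) :
    Lk s (cubicChar hpos h3) =
      ∑' p : PrimaryPairs, charVal hpos h3 p.1.1 p.1.2 * normPow s p.1 := by
  rw [Lk, ← primaryIdeal_injective.tsum_eq]
  · exact tsum_congr fun p => lTerm_primaryIdeal hpos h3 s p
  · intro I hI
    by_contra h
    exact hI (lTerm_eq_zero _ s h)

/-! ### Splitting off the content -/

/-- The integers `≡ 1` modulo `3`. -/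
abbrev PrimaryInts : Type := {e : ℤ // e % 3 = 1}

/-- Exactly one of `±m` is `≡ 1` modulo `3` when `3 ∤ m`, so sums over such integers become sums
over natural numbers prime to `3`. -/
theorem PrimaryInts.natAbs_injective : Function.Injective fun e : PrimaryInts => e.1.natAbs := by
  intro e f h
  have he := e.2
  have hf := f.2
  have h : e.1.natAbs = f.1.natAbs := h
  apply Subtype.ext
  omega

theorem Primary.mul {e a b : ℤ} (he : e % 3 = 1) (h : Primary a b) : Primary (e * a) (e * b) := by
  obtain ⟨h1, h2⟩ := h
  refine ⟨?_, ?_⟩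
  · rw [Int.mul_emod, he, h1]; rfl
  · rw [Int.mul_emod, he, h2]; rfl

/-- Multiplication of a primitive primary element by a rational integer `≡ 1` modulo `3`. -/
def contentMul (x : PrimaryInts × PrimitivePairs) : PrimaryPairs :=
  ⟨(x.1.1 * x.2.1.1, x.1.1 * x.2.1.2), x.2.2.1.mul x.1.2⟩

theorem contentMul_bijective : Function.Bijective contentMul := by
  constructor
  · rintro ⟨⟨e, he⟩, ⟨⟨a, b⟩, hp, hab⟩⟩ ⟨⟨f, hf⟩, ⟨⟨c, d⟩, hq, hcd⟩⟩ h
    have h := congrArg Subtype.val h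
    simp only [contentMul, Prod.mk.injEq] at h
    obtain ⟨h1, h2⟩ := h
    have hef : e = f := by
      have g1 : Int.gcd (e * a) (e * b) = e.natAbs := by
        rw [Int.gcd_mul_left, Int.isCoprime_iff_gcd_eq_one.1 hab, mul_one]
      have g2 : Int.gcd (f * c) (f * d) = f.natAbs := by
        rw [Int.gcd_mul_left, Int.isCoprime_iff_gcd_eq_one.1 hcd, mul_one]
      rw [h1, h2, g2] at g1
      omega
    subst hef
    have he0 : e ≠ 0 := by rintro rfl; simp at he
    have ha := mul_left_cancel₀ he0 h1
    have hb := mul_left_cancel₀ he0 h2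
    subst ha hb
    rfl
  · rintro ⟨⟨a, b⟩, hp⟩
    have hg0 : 0 < Int.gcd a b := by
      rw [Nat.pos_iff_ne_zero, Ne, Int.gcd_eq_zero_iff]
      rintro ⟨rfl, rfl⟩
      exact hp.ne_zero rfl
    obtain ⟨a', b', hab, ha, hb⟩ := Int.exists_gcd_one hg0
    set g : ℤ := (Int.gcd a b : ℤ)
    obtain ⟨h1, h2⟩ := hp
    simp only at h1 h2
    have hg3 : ¬ (3 : ℤ) ∣ g := by
      intro h
      have : (3 : ℤ) ∣ a := ha ▸ Dvd.dvd.mul_left h a'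
      omega
    -- The content is the gcd with its sign chosen so that it is `≡ 1` modulo `3`; the cofactors
    -- change sign with it.
    obtain ⟨e, c, d, he, hcd, hac, hbd⟩ : ∃ e c d : ℤ, e % 3 = 1 ∧ IsCoprime c d ∧
        a = e * c ∧ b = e * d := by
      have hc : IsCoprime a' b' := Int.isCoprime_iff_gcd_eq_one.2 hab
      rcases (by omega : g % 3 = 1 ∨ (-g) % 3 = 1) with h | h
      · exact ⟨g, a', b', h, hc, by rw [ha]; ring, by rw [hb]; ring⟩
      · exact ⟨-g, -a', -b', h, hc.neg_neg, by rw [ha]; ring, by rw [hb]; ring⟩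
    have hprim : Primary c d := by
      rw [hac, Int.mul_emod, he] at h1
      rw [hbd, Int.mul_emod, he] at h2
      constructor <;> omega
    exact ⟨⟨⟨e, he⟩, ⟨(c, d), hprim, hcd⟩⟩, Subtype.ext (Prod.ext hac.symm hbd.symm)⟩

theorem normPow_contentMul (s : ℂ) (x : PrimaryInts × PrimitivePairs) :
    normPow s (contentMul x).1 = (x.1.1.natAbs : ℂ) ^ (-(2 * s)) * normPow s x.2.1 := by
  have h0 : (x.1.1.natAbs : ℂ) ≠ 0 := by
    have := x.1.2
    have : x.1.1.natAbs ≠ 0 := by omega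
    exact_mod_cast this
  have hN : ((normForm x.2.1.1 x.2.1.2 : ℤ) : ℂ) = ((normForm x.2.1.1 x.2.1.2).natAbs : ℂ) := by
    rw [← Int.cast_natCast, Int.natAbs_of_nonneg (normForm_nonneg _ _)]
  have he : ((normForm (x.1.1 * x.2.1.1) (x.1.1 * x.2.1.2) : ℤ) : ℂ) =
      ((x.1.1.natAbs * x.1.1.natAbs : ℕ) : ℂ) * ((normForm x.2.1.1 x.2.1.2).natAbs : ℂ) := by
    rw [← hN, ← Int.cast_natCast (_ * _), ← Int.cast_mul]
    congr 1
    rw [Int.natAbs_mul_self]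
    simp only [normForm]; ring
  simp only [normPow, contentMul]
  rw [he, Complex.natCast_mul_natCast_cpow, ← hN, Nat.cast_mul, Complex.natCast_mul_natCast_cpow,
    ← Complex.cpow_add _ _ h0]
  congr 2
  ring

-- The sum is the `L`-series of the trivial Dirichlet character modulo `3n`: its nonzero terms have
-- index prime to `3`, hence of the form `|e|` for a unique `e ≡ 1` modulo `3`.
open Classical in
theorem tsum_primaryInts (hpos : 0 < n) {s : ℂ} (hs : 1 < s.re) :
    ∑' e : PrimaryInts, (if IsCoprime e.1 ((3 * n : ℕ) : ℤ) then (1 : ℂ) else 0) *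
        (e.1.natAbs : ℂ) ^ (-s) =
      (∏ p ∈ (3 * n).primeFactors, (1 - (p : ℂ) ^ (-s))) * riemannZeta s := by
  have : NeZero (3 * n) := ⟨by positivity⟩
  rw [← DirichletCharacter.LFunctionTrivChar_eq_mul_riemannZeta (N := 3 * n)
    (by rintro rfl; simp at hs), DirichletCharacter.LFunctionTrivChar,
    DirichletCharacter.LFunction_eq_LSeries _ hs, LSeries,
    ← PrimaryInts.natAbs_injective.tsum_eq]
  · refine tsum_congr fun e => ?_
    have h0 : e.1.natAbs ≠ 0 := by have := e.2; omega
    rw [LSeries.term_of_ne_zero h0, Complex.cpow_neg, ← div_eq_mul_inv]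
    congr 1
    have hiff : IsCoprime e.1 ((3 * n : ℕ) : ℤ) ↔ IsUnit ((e.1.natAbs : ℕ) : ZMod (3 * n)) := by
      rw [ZMod.isUnit_iff_coprime, Int.isCoprime_iff_gcd_eq_one]
      rfl
    split_ifs with h
    · rw [MulChar.one_apply (hiff.1 h)]
    · rw [MulChar.map_nonunit _ fun hu => h (hiff.2 hu)]
  · intro m hm
    have hu : IsUnit (m : ZMod (3 * n)) := by
      by_contra h
      apply hm
      rw [LSeries.term_def]
      split_ifs
      · rfl
      · rw [MulChar.map_nonunit _ h, zero_div]
    rw [ZMod.isUnit_iff_coprime] at hu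
    have h3 : m % 3 ≠ 0 := fun h => by
      have := Nat.eq_one_of_dvd_coprimes hu (Nat.dvd_of_mod_eq_zero h) (Nat.dvd_mul_right 3 n)
      omega
    rcases (by omega : (m : ℤ) % 3 = 1 ∨ (-(m : ℤ)) % 3 = 1) with h | h
    · exact ⟨⟨m, h⟩, by simp⟩
    · exact ⟨⟨-m, h⟩, by simp⟩

theorem prod_primeFactors_three_mul (hpos : 0 < n) (h3 : Nat.Coprime n 3) (g : ℕ → ℂ) :
    ∏ p ∈ (3 * n).primeFactors, g p = g 3 * ∏ p ∈ n.primeFactors, g p := by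
  rw [Nat.primeFactors_mul (by norm_num) hpos.ne', Nat.prime_three.primeFactors,
    Finset.singleton_union, Finset.prod_insert]
  intro h
  have := Nat.eq_one_of_dvd_coprimes h3 (Nat.dvd_of_mem_primeFactors h) dvd_rfl
  omega

/-- The part of the `L`-series given by the primitive primary elements. -/
def primitiveSum (hpos : 0 < n) (h3 : Nat.Coprime n 3) (s : ℂ) : ℂ :=
  ∑' p : PrimitivePairs, charVal hpos h3 p.1.1 p.1.2 * normPow s p.1

theorem Lk_eq_mul_primitiveSum (hpos : 0 < n) (h3 : Nat.Coprime n 3) {s : ℂ} (hs : 1 < s.re) :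
    Lk s (cubicChar hpos h3) =
      (1 - (3 : ℂ) ^ (-2 * s)) * (∏ p ∈ n.primeFactors, (1 - (p : ℂ) ^ (-2 * s))) *
        riemannZeta (2 * s) * primitiveSum hpos h3 s := by
  classical
  have h2s : 1 < (2 * s).re := by simp; linarith
  have hE := tsum_primaryInts hpos h2s
  rw [prod_primeFactors_three_mul hpos h3 fun p => 1 - (p : ℂ) ^ (-(2 * s))] at hE
  rw [neg_mul, ← Nat.cast_ofNat (R := ℂ) (n := 3), ← hE, Lk_eq_tsum_primaryPairs, primitiveSum,
    tsum_mul_tsum_of_summable_norm]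
  · rw [← (Equiv.ofBijective _ contentMul_bijective).tsum_eq]
    refine tsum_congr fun x => ?_
    rw [Equiv.ofBijective_apply, normPow_contentMul]
    simp only [contentMul, charVal_mul_int]
    ring
  · have h1 : Summable fun m : ℕ => ‖((1 : ℝ) : ℂ) * (m : ℂ) ^ (-(2 * s))‖ := by
      have := (Complex.summable_one_div_nat_cpow (p := 2 * s)).2 h2s
      refine this.norm.congr fun m => ?_
      rw [Complex.cpow_neg]; simp
    refine Summable.of_nonneg_of_le (fun _ => norm_nonneg _) (fun e => ?_)
      (h1.comp_injective PrimaryInts.natAbs_injective)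
    simp only [Function.comp, norm_mul]
    refine mul_le_mul_of_nonneg_right ?_ (norm_nonneg _)
    split_ifs <;> simp
  · exact summable_norm_mul_normPow hs Subtype.val_injective PrimitivePairs.ne_zero
      (fun p => norm_charVal_le_one hpos h3 p.1.1 p.1.2)

theorem one_sub_natCast_cpow_ne_zero {m : ℕ} (hm : 1 < m) {s : ℂ} (hs : 1 < s.re) :
    1 - (m : ℂ) ^ (-2 * s) ≠ 0 := by
  intro h
  have h1 : ‖(m : ℂ) ^ (-2 * s)‖ < 1 := by
    rw [Complex.norm_natCast_cpow_of_pos (by omega)]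
    refine Real.rpow_lt_one_of_one_lt_of_neg (by exact_mod_cast hm) ?_
    simp; linarith
  rw [← sub_eq_zero.1 h] at h1
  simp at h1

/-! ### The weights -/

variable {n : ℕ}

theorem largestSquarefreeDivisor_eq (hpos : 0 < n) :
    largestSquarefreeDivisor n = ∏ p ∈ n.primeFactors, p := by
  have hdvd : ∏ p ∈ n.primeFactors, p ∣ n := Nat.prod_primeFactors_dvd n
  apply le_antisymm
  · refine Finset.sup_le fun d hd => ?_
    obtain ⟨hd, hsq⟩ := Finset.mem_filter.1 hd
    have hdn := Nat.dvd_of_mem_divisors hd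
    rw [id, ← Nat.prod_primeFactors_of_squarefree hsq]
    exact Nat.le_of_dvd (Finset.prod_pos fun p hp => Nat.pos_of_mem_primeFactors hp)
      (Finset.prod_dvd_prod_of_subset _ _ _ (Nat.primeFactors_mono hdn hpos.ne'))
  · refine Finset.le_sup (f := id) (Finset.mem_filter.2 ⟨Nat.mem_divisors.2 ⟨hdvd, hpos.ne'⟩, ?_⟩)
    exact Finset.squarefree_prod_of_pairwise_isCoprime
      (fun p hp q hq hpq => Nat.coprime_iff_isRelPrime.1 <|
        (Nat.coprime_primes (Nat.prime_of_mem_primeFactors hp)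
          (Nat.prime_of_mem_primeFactors hq)).2 hpq)
      fun p hp => (Nat.prime_of_mem_primeFactors hp).squarefree

theorem largestSquarefreeDivisor_dvd (hpos : 0 < n) : largestSquarefreeDivisor n ∣ n :=
  largestSquarefreeDivisor_eq hpos ▸ Nat.prod_primeFactors_dvd n

theorem largestSquarefreeDivisor_pos (hpos : 0 < n) : 0 < largestSquarefreeDivisor n :=
  Nat.pos_of_dvd_of_pos (largestSquarefreeDivisor_dvd hpos) hpos

theorem primeFactors_eq_of_largestSquarefreeDivisor_dvd (hpos : 0 < n) {d : ℕ} (hd : d ∣ n)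
    (h : largestSquarefreeDivisor n ∣ d) : d.primeFactors = n.primeFactors := by
  refine (Nat.primeFactors_mono hd hpos.ne').antisymm fun p hp => ?_
  refine Nat.mem_primeFactors.2 ⟨Nat.prime_of_mem_primeFactors hp, ?_,
    (Nat.pos_of_dvd_of_pos hd hpos).ne'⟩
  rw [largestSquarefreeDivisor_eq hpos] at h
  exact (Finset.dvd_prod_of_mem _ hp).trans h

/-- The factor `∑_{n' ∣ d ∣ n} dn ∏_{p ∣ d} (1 - p⁻²)` of the second part of `C(α, β)`. -/
def characterWeight (n : ℕ) : ℝ :=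
  ∑ d ∈ n.divisors with largestSquarefreeDivisor n ∣ d,
    (d : ℝ) * (n : ℝ) * ∏ p ∈ d.primeFactors, (1 - ((p : ℝ) ^ 2)⁻¹)

/-- Every `d` in the sum has the same primes as `n`, so the product over primes is constant; writing
`d = n'e` with `e ∣ n/n'` leaves a divisor sum. -/
theorem characterWeight_eq (hpos : 0 < n) :
    characterWeight n = n * (largestSquarefreeDivisor n *
      ArithmeticFunction.sigma 1 (n / largestSquarefreeDivisor n)) *
      ∏ p ∈ n.primeFactors, (1 - ((p : ℝ) ^ 2)⁻¹) := by
  set r := largestSquarefreeDivisor n with hr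
  have hrpos : 0 < r := largestSquarefreeDivisor_pos hpos
  have hrn : r ∣ n := largestSquarefreeDivisor_dvd hpos
  have hfilter : n.divisors.filter (r ∣ ·) = (n / r).divisors.image (r * ·) := by
    ext d
    simp only [Finset.mem_filter, Nat.mem_divisors, Finset.mem_image]
    constructor
    · rintro ⟨⟨hd, -⟩, e, rfl⟩
      exact ⟨e, ⟨(Nat.dvd_div_iff_mul_dvd hrn).2 hd,
        (Nat.div_pos (Nat.le_of_dvd hpos hrn) hrpos).ne'⟩, rfl⟩
    · rintro ⟨e, ⟨he, -⟩, rfl⟩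
      exact ⟨⟨(Nat.dvd_div_iff_mul_dvd hrn).1 he, hpos.ne'⟩, Nat.dvd_mul_right _ _⟩
  have hsum : ∑ d ∈ n.divisors with r ∣ d, (d : ℝ) =
      r * ArithmeticFunction.sigma 1 (n / r) := by
    rw [hfilter, Finset.sum_image fun a _ b _ h => Nat.eq_of_mul_eq_mul_left hrpos h,
      ArithmeticFunction.sigma_one_apply, Nat.cast_sum, Finset.mul_sum]
    exact Finset.sum_congr rfl fun e _ => Nat.cast_mul r e
  rw [characterWeight, ← hsum, Finset.mul_sum, Finset.sum_mul]
  refine Finset.sum_congr rfl fun d hd => ?_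
  obtain ⟨hd, hrd⟩ := Finset.mem_filter.1 hd
  rw [primeFactors_eq_of_largestSquarefreeDivisor_dvd hpos (Nat.dvd_of_mem_divisors hd) hrd]
  ring

/-- The first part of the weight `C(α, β)`, as a function of `m = α² + αβ + β²`. -/
def normWeight (n : ℕ) (m : ℤ) : ℝ :=
  ∑ d ∈ n.divisors with Nat.gcd d (Int.gcd n m) = 1,
    (d : ℝ) ^ 2 * (f n / (3 * f d)) * ∏ p ∈ d.primeFactors, (1 - ((p : ℝ) ^ 2)⁻¹)

theorem exists_abs_normWeight_le (n : ℕ) : ∃ B : ℝ, ∀ m, |normWeight n m| ≤ B :=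
  ⟨_, fun _ => (Finset.abs_sum_le_sum_abs _ _).trans
    (Finset.sum_le_sum_of_subset_of_nonneg (Finset.filter_subset _ _) fun _ _ _ => abs_nonneg _)⟩

theorem C_neg_right (n : ℕ) (a b : ℤ) :
    C n a (-b) = normWeight n (normForm a b) +
      2 / 3 * (cubicProd n (eis a b)).re * characterWeight n := by
  have h1 : ((a : 𝓞 k) - ((-b : ℤ) : 𝓞 k) * omegaO) = eis a b := by
    simp only [eis]; push_cast; ring
  have h2 : a ^ 2 + a * -b + (-b) ^ 2 = normForm a b := by simp only [normForm]; ring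
  rw [C, delta, h1, h2, normWeight, characterWeight]

/-- Here `b - aω = -ω((a + b) + bω)`: the sign is invisible to the symbols, while the unit `ω`
contributes the factor `χ(ω)`. -/
theorem C_swap (hpos : 0 < n) (h3 : Nat.Coprime n 3) (a b : ℤ) :
    C n b a = normWeight n (normForm (a + b) b) +
      2 / 3 * (cubicProd n omegaO * cubicProd n (eis (a + b) b)).re * characterWeight n := by
  have h1 : ((b : 𝓞 k) - (a : 𝓞 k) * omegaO) = -(omegaO * eis (a + b) b) := by
    simp only [eis]; push_cast
    linear_combination (b : 𝓞 k) * omegaO_sq_add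
  have h2 : b ^ 2 + b * a + a ^ 2 = normForm (a + b) b := by simp only [normForm]; ring
  rw [C, delta, h1, h2, cubicProd_neg hpos h3, cubicProd_mul hpos h3, normWeight, characterWeight]

/-! ### Cosets and primitive pairs -/

theorem mem_Gamma_three_iff (γ : SL(2, ℤ)) :
    γ ∈ CongruenceSubgroup.Gamma 3 ↔
      γ 0 0 % 3 = 1 ∧ γ 0 1 % 3 = 0 ∧ γ 1 0 % 3 = 0 ∧ γ 1 1 % 3 = 1 := by
  have h1 : ∀ a : ℤ, (a : ZMod 3) = 1 ↔ a % 3 = 1 := fun a => by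
    have := ZMod.intCast_eq_intCast_iff a 1 3
    rw [Int.cast_one] at this
    exact this
  have h0 : ∀ a : ℤ, (a : ZMod 3) = 0 ↔ a % 3 = 0 := fun a => by
    have := ZMod.intCast_eq_intCast_iff a 0 3
    rw [Int.cast_zero] at this
    exact this
  rw [CongruenceSubgroup.Gamma_mem, h1, h0, h0, h1]

theorem det_eq_one (γ : SL(2, ℤ)) : γ 0 0 * γ 1 1 - γ 0 1 * γ 1 0 = 1 := by
  have := γ.det_coe
  rwa [Matrix.det_fin_two] at this

/-- The bottom row `(c, d)` of a matrix in `Γ(3)`, as the primitive pair `(d, c)`. -/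
def bottomRow (γ : CongruenceSubgroup.Gamma 3) : PrimitivePairs :=
  ⟨(γ.1 1 1, γ.1 1 0), ⟨((mem_Gamma_three_iff γ.1).1 γ.2).2.2.2,
    ((mem_Gamma_three_iff γ.1).1 γ.2).2.2.1⟩, γ.1 0 0, -γ.1 0 1, by
      linear_combination det_eq_one γ.1⟩

theorem bottomRow_eq_iff (x y : CongruenceSubgroup.Gamma 3) :
    bottomRow x = bottomRow y ↔ y * x⁻¹ ∈ T3 := by
  rw [T3, Subgroup.mem_subgroupOf, Subgroup.mem_zpowers_iff]
  constructor
  · intro h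
    have h := congrArg Subtype.val h
    simp only [bottomRow, Prod.mk.injEq] at h
    obtain ⟨h11, h10⟩ := h
    obtain ⟨x00, x01, x10, x11⟩ := (mem_Gamma_three_iff x.1).1 x.2
    obtain ⟨y00, y01, y10, y11⟩ := (mem_Gamma_three_iff y.1).1 y.2
    have dx := det_eq_one x.1
    have dy := det_eq_one y.1
    rw [← h11, ← h10] at dy
    -- With equal bottom rows, `y x⁻¹` is unipotent, and `m` is its upper right entry.
    set m := y.1 0 1 * x.1 0 0 - y.1 0 0 * x.1 0 1 with hm
    have hy : y.1 = ModularGroup.T ^ m * x.1 := by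
      ext i j
      rw [Matrix.SpecialLinearGroup.coe_mul, ModularGroup.coe_T_zpow]
      fin_cases i <;> fin_cases j <;>
        simp [Matrix.mul_apply, Fin.sum_univ_two, h11, h10]
      · rw [← h10, hm]; linear_combination x.1 0 0 * dy - y.1 0 0 * dx
      · rw [← h11, hm]; linear_combination x.1 0 1 * dy - y.1 0 1 * dx
    have hm3 : m % 3 = 0 := by
      rw [hm, Int.sub_emod, Int.mul_emod, y01, Int.mul_emod (y.1 0 0), x01]; simp
    refine ⟨m / 3, ?_⟩
    rw [← zpow_natCast, ← zpow_mul, show ((3 : ℕ) : ℤ) * (m / 3) = m by push_cast; omega]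
    push_cast
    rw [hy, mul_inv_cancel_right]
  · rintro ⟨m, hm⟩
    have hy : (y : SL(2, ℤ)) = ModularGroup.T ^ (3 * m) * (x : SL(2, ℤ)) := by
      rw [zpow_mul, zpow_ofNat, hm]; simp
    have h : y.1 1 = x.1 1 := by
      rw [hy]; exact ModularGroup.T_pow_mul_apply_one (3 * m) x.1
    exact Subtype.ext (Prod.ext (congrFun h 1).symm (congrFun h 0).symm)

/-- The bottom row of a coset in `⟨T³⟩ \ Γ(3)`. -/
def cosetRow : Cosets → PrimitivePairs :=
  Quotient.lift bottomRow fun x y h => (bottomRow_eq_iff x y).2 (QuotientGroup.rightRel_apply.1 h)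

theorem cosetRow_bijective : Function.Bijective cosetRow := by
  constructor
  · intro x y
    induction x using Quotient.inductionOn
    induction y using Quotient.inductionOn
    intro h
    exact Quotient.sound (QuotientGroup.rightRel_apply.2 ((bottomRow_eq_iff _ _).1 h))
  · rintro ⟨⟨d, c⟩, ⟨hd, hc⟩, u, v, huv⟩
    simp only at hd hc huv
    -- The Bézout relation gives the top row `(u, -v)`. Adding `v` times the bottom row makes the
    -- upper right entry `v(d - 1)`, which is divisible by `3`.
    let γ : SL(2, ℤ) := ⟨!![u + v * c, -v + v * d; c, d], by
      rw [Matrix.det_fin_two_of]; linear_combination huv⟩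
    obtain ⟨c', rfl⟩ : ∃ c', c = 3 * c' := ⟨c / 3, by omega⟩
    obtain ⟨d', rfl⟩ : ∃ d', d = 3 * d' + 1 := ⟨d / 3, by omega⟩
    have hu : u % 3 = 1 := by
      have : u = 1 + 3 * (-(u * d') - v * c') := by linear_combination huv
      omega
    have hγ : γ ∈ CongruenceSubgroup.Gamma 3 := by
      rw [mem_Gamma_three_iff]
      refine ⟨?_, ?_, hc, hd⟩
      · change (u + v * (3 * c')) % 3 = 1
        rw [show u + v * (3 * c') = u + 3 * (v * c') by ring]; omega
      · change (-v + v * (3 * d' + 1)) % 3 = 0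
        rw [show -v + v * (3 * d' + 1) = 3 * (v * d') by ring]; omega
    exact ⟨Quotient.mk _ ⟨γ, hγ⟩, rfl⟩

theorem im_smul_omegaH (γ : SL(2, ℤ)) :
    (γ • omegaH).im = Real.sqrt 3 / 2 / normForm (γ 1 1) (γ 1 0) := by
  rw [ModularGroup.im_smul_eq_div_normSq, ModularGroup.denom_apply, ← normSq_eis, add_comm]
  congr 1
  exact omega_im

theorem im_smul_S_smul_omegaH (γ : SL(2, ℤ)) :
    (γ • (ModularGroup.S • omegaH)).im =
      Real.sqrt 3 / 2 / normForm (γ 1 1 + γ 1 0) (γ 1 0) := by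
  rw [← mul_smul, im_smul_omegaH]
  have h0 : (γ * ModularGroup.S) 1 0 = γ 1 1 := by
    rw [Matrix.SpecialLinearGroup.coe_mul, ModularGroup.coe_S]
    simp [Matrix.mul_apply, Fin.sum_univ_two]
  have h1 : (γ * ModularGroup.S) 1 1 = -γ 1 0 := by
    rw [Matrix.SpecialLinearGroup.coe_mul, ModularGroup.coe_S]
    simp [Matrix.mul_apply, Fin.sum_univ_two]
  rw [h0, h1]
  congr 2
  simp only [normForm]; ring

theorem ofReal_div_normForm_cpow (s : ℂ) {h : ℝ} (h0 : 0 ≤ h) (p : ℤ × ℤ) :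
    ((h / normForm p.1 p.2 : ℝ) : ℂ) ^ s = (h : ℂ) ^ s * normPow s p := by
  have hN : (0 : ℝ) ≤ normForm p.1 p.2 := by exact_mod_cast normForm_nonneg _ _
  rw [Complex.ofReal_div, Complex.div_cpow_ofReal_nonneg h0 hN, normPow, Complex.cpow_neg,
    div_eq_mul_inv, Complex.ofReal_intCast]

/-! ### Symmetries of the primitive pairs -/

/-- `(a, b) ↦ (a + b, b)`; up to a unit, the effect of `S` on bottom rows. -/
def shiftEquiv : PrimitivePairs ≃ PrimitivePairs where
  toFun p := ⟨(p.1.1 + p.1.2, p.1.2), by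
    obtain ⟨⟨h1, h2⟩, h⟩ := p.2
    refine ⟨⟨?_, h2⟩, ?_⟩
    · simp only; omega
    · simpa using h.add_mul_left_left 1⟩
  invFun p := ⟨(p.1.1 - p.1.2, p.1.2), by
    obtain ⟨⟨h1, h2⟩, h⟩ := p.2
    refine ⟨⟨?_, h2⟩, ?_⟩
    · simp only; omega
    · simpa [sub_eq_add_neg] using h.add_mul_left_left (-1)⟩
  left_inv p := by simp
  right_inv p := by simp

/-- Complex conjugation `(a, b) ↦ (a - b, -b)` of `a + bω`. -/
def conjEquiv : PrimitivePairs ≃ PrimitivePairs where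
  toFun p := ⟨(p.1.1 - p.1.2, -p.1.2), by
    obtain ⟨⟨h1, h2⟩, h⟩ := p.2
    refine ⟨⟨?_, ?_⟩, ?_⟩
    · simp only; omega
    · simp only; omega
    · simpa [sub_eq_add_neg] using (h.add_mul_left_left (-1)).neg_right⟩
  invFun p := ⟨(p.1.1 - p.1.2, -p.1.2), by
    obtain ⟨⟨h1, h2⟩, h⟩ := p.2
    refine ⟨⟨?_, ?_⟩, ?_⟩
    · simp only; omega
    · simp only; omega
    · simpa [sub_eq_add_neg] using (h.add_mul_left_left (-1)).neg_right⟩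
  left_inv p := by simp
  right_inv p := by simp

theorem charVal_conjEquiv (hpos : 0 < n) (h3 : Nat.Coprime n 3) (p : PrimitivePairs) :
    charVal hpos h3 (conjEquiv p).1.1 (conjEquiv p).1.2 = conj (charVal hpos h3 p.1.1 p.1.2) := by
  rw [charVal_eq_cubicProd hpos h3 (conjEquiv p).2.1, charVal_eq_cubicProd hpos h3 p.2.1,
    ← cubicProd_conj hpos h3, conjO_eis]
  rfl

theorem normPow_conjEquiv (s : ℂ) (p : PrimitivePairs) :
    normPow s (conjEquiv p).1 = normPow s p.1 := by
  simp only [normPow, conjEquiv, Equiv.coe_fn_mk, normForm]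
  congr 2
  ring

/-! ### The sum over cosets -/

theorem hasSum_primitiveSum (hpos : 0 < n) (h3 : Nat.Coprime n 3) {s : ℂ} (hs : 1 < s.re) :
    HasSum (fun p : PrimitivePairs => charVal hpos h3 p.1.1 p.1.2 * normPow s p.1)
      (primitiveSum hpos h3 s) :=
  (summable_norm_mul_normPow hs Subtype.val_injective PrimitivePairs.ne_zero
    (fun p => norm_charVal_le_one hpos h3 p.1.1 p.1.2)).of_norm.hasSum

/-- Reindexing by conjugation of `a + bω` conjugates the character and preserves the norm. The
exponent `s` is not conjugated, so this is not the conjugate of the preceding sum. -/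
theorem hasSum_conj_charVal (hpos : 0 < n) (h3 : Nat.Coprime n 3) {s : ℂ} (hs : 1 < s.re) :
    HasSum (fun p : PrimitivePairs => conj (charVal hpos h3 p.1.1 p.1.2) * normPow s p.1)
      (primitiveSum hpos h3 s) := by
  convert conjEquiv.hasSum_iff.2 (hasSum_primitiveSum hpos h3 hs) using 2 with p
  rw [Function.comp_apply, charVal_conjEquiv, normPow_conjEquiv]

theorem hasSum_re_mul_charVal (hpos : 0 < n) (h3 : Nat.Coprime n 3) {s : ℂ} (hs : 1 < s.re)
    (η : ℂ) :
    HasSum (fun p : PrimitivePairs =>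
        ((η * charVal hpos h3 p.1.1 p.1.2).re : ℂ) * normPow s p.1)
      (η.re * primitiveSum hpos h3 s) := by
  have h := ((hasSum_primitiveSum hpos h3 hs).mul_left (η / 2)).add
    ((hasSum_conj_charVal hpos h3 hs).mul_left (conj η / 2))
  have e : η / 2 * primitiveSum hpos h3 s + conj η / 2 * primitiveSum hpos h3 s =
      η.re * primitiveSum hpos h3 s := by
    rw [Complex.re_eq_add_conj]; ring
  rw [e] at h
  have e' : ∀ p : PrimitivePairs, ((η * charVal hpos h3 p.1.1 p.1.2).re : ℂ) * normPow s p.1 =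
      η / 2 * (charVal hpos h3 p.1.1 p.1.2 * normPow s p.1) +
        conj η / 2 * (conj (charVal hpos h3 p.1.1 p.1.2) * normPow s p.1) := fun p => by
    rw [Complex.re_eq_add_conj, map_mul]; ring
  simp only [e']
  exact h

/-- The summand of `F(ω, s)` at the primitive pair `p = (d, c)`, up to the factor `(√3/2)^s`, is the
difference of this function for `η = 1` at `p` and for `η = χ(ω)` at `(d + c, c)`. -/
def pairTerm (hpos : 0 < n) (h3 : Nat.Coprime n 3) (s η : ℂ) (p : PrimitivePairs) : ℂ :=
  ((normWeight n (normForm p.1.1 p.1.2) +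
    2 / 3 * (η * charVal hpos h3 p.1.1 p.1.2).re * characterWeight n : ℝ) : ℂ) * normPow s p.1

theorem hasSum_pairTerm (hpos : 0 < n) (h3 : Nat.Coprime n 3) {s : ℂ} (hs : 1 < s.re) (η : ℂ) :
    HasSum (pairTerm hpos h3 s η)
      ((∑' p : PrimitivePairs, (normWeight n (normForm p.1.1 p.1.2) : ℂ) * normPow s p.1) +
        2 / 3 * characterWeight n * (η.re * primitiveSum hpos h3 s)) := by
  obtain ⟨B, hB⟩ := exists_abs_normWeight_le n
  have h1 : Summable fun p : PrimitivePairs =>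
      (normWeight n (normForm p.1.1 p.1.2) : ℂ) * normPow s p.1 :=
    (summable_norm_mul_normPow hs Subtype.val_injective PrimitivePairs.ne_zero (B := B)
      (fun p => by rw [Complex.norm_real]; exact hB _)).of_norm
  convert h1.hasSum.add ((hasSum_re_mul_charVal hpos h3 hs η).mul_left
    (2 / 3 * (characterWeight n : ℂ))) using 2 with p
  simp only [pairTerm]; push_cast; ring

theorem cosetTerm_omegaH (hpos : 0 < n) (h3 : Nat.Coprime n 3) (s : ℂ) (q : Cosets) :
    cosetTerm n omegaH s q = ((Real.sqrt 3 / 2 : ℝ) : ℂ) ^ s *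
      (pairTerm hpos h3 s 1 (cosetRow q) -
        pairTerm hpos h3 s (cubicProd n omegaO) (shiftEquiv (cosetRow q))) := by
  induction q using Quotient.inductionOn with | _ γ
  change termAt n omegaH s γ.1 = _ * (pairTerm hpos h3 s 1 (bottomRow γ) -
        pairTerm hpos h3 s (cubicProd n omegaO) (shiftEquiv (bottomRow γ)))
  have h0 : (0 : ℝ) ≤ Real.sqrt 3 / 2 := by positivity
  rw [termAt, im_smul_omegaH, im_smul_S_smul_omegaH, C_neg_right, C_swap hpos h3,
    ofReal_div_normForm_cpow s h0 (γ.1 1 1, γ.1 1 0),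
    ofReal_div_normForm_cpow s h0 (γ.1 1 1 + γ.1 1 0, γ.1 1 0)]
  rw [pairTerm, pairTerm, charVal_eq_cubicProd hpos h3 (bottomRow γ).2.1,
    charVal_eq_cubicProd hpos h3 (shiftEquiv (bottomRow γ)).2.1, one_mul]
  simp only [bottomRow, shiftEquiv, Equiv.coe_fn_mk]
  ring

theorem hasSum_cosetTerm (hpos : 0 < n) (h3 : Nat.Coprime n 3) {s : ℂ} (hs : 1 < s.re)
    (hω : (cubicProd n omegaO).re = -1 / 2) :
    HasSum (cosetTerm n omegaH s)
      (((Real.sqrt 3 / 2 : ℝ) : ℂ) ^ s * (characterWeight n * primitiveSum hpos h3 s)) := by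
  have h := ((hasSum_pairTerm hpos h3 hs 1).sub
    (shiftEquiv.hasSum_iff.2 (hasSum_pairTerm hpos h3 hs (cubicProd n omegaO)))).mul_left
    (((Real.sqrt 3 / 2 : ℝ) : ℂ) ^ s)
  rw [← (Equiv.ofBijective _ cosetRow_bijective).hasSum_iff] at h
  rw [show cosetTerm n omegaH s = _ from funext (cosetTerm_omegaH hpos h3 s)]
  rw [hω, Complex.one_re] at h
  -- The norm part `a` cancels, and `(2/3)(1 + 1/2) = 1`.
  have e : ∀ a b c : ℂ, a + 2 / 3 * b * (((1 : ℝ) : ℂ) * c) -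
      (a + 2 / 3 * b * (((-1 / 2 : ℝ) : ℂ) * c)) = b * c := fun a b c => by push_cast; ring
  rw [e] at h
  exact h

end CubicEisenstein

end

/-! ### The evaluation of `F(ω, s)` -/

open CubicEisenstein in
theorem mainTheorem5 (n : ℕ) (hpos : 0 < n) (hcop : Nat.Coprime n 6)
    (h1 : ¬ (n : ℤ) ≡ 1 [ZMOD 9]) (h2 : ¬ (n : ℤ) ≡ -1 [ZMOD 9])
    (hexp : ∀ p ∈ n.primeFactors, ¬ 3 ∣ n.factorization p) :
    ∃ χ : MulChar (𝓞 CubicEisenstein.k ⧸ CubicEisenstein.modulus n) ℂ,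
      (∀ z : 𝓞 CubicEisenstein.k, IsUnit (Ideal.Quotient.mk (CubicEisenstein.modulus n) z) →
        χ (Ideal.Quotient.mk (CubicEisenstein.modulus n) z) = CubicEisenstein.cubicProd n z) ∧
      ∀ s : ℂ, 1 < s.re →
        Summable (CubicEisenstein.cosetTerm n CubicEisenstein.omegaH s) ∧
        Summable (CubicEisenstein.lTerm χ s) ∧
        CubicEisenstein.F n CubicEisenstein.omegaH s =
          2 * Real.pi * (CubicEisenstein.largestSquarefreeDivisor n : ℂ) *
              (ArithmeticFunction.sigma 1 (n / CubicEisenstein.largestSquarefreeDivisor n) : ℂ) /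
            (3 * (1 - (3 : ℂ) ^ (-2 * s))) *
          ((Real.sqrt 3 / 2 : ℝ) : ℂ) ^ s *
          (CubicEisenstein.Lk s χ / riemannZeta (2 * s)) *
          ∏ p ∈ n.primeFactors, (1 - ((p : ℂ) ^ 2)⁻¹) / (1 - (p : ℂ) ^ (-2 * s)) := by
  have h3 : Nat.Coprime n 3 := hcop.coprime_dvd_right (by norm_num)
  refine ⟨cubicChar hpos h3, fun z hz => cubicChar_apply hpos h3 hz, fun s hs => ?_⟩
  have hsum := hasSum_cosetTerm hpos h3 hs (cubicProd_omegaO_re hpos h3 h1 h2)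
  refine ⟨hsum.summable, summable_lTerm hpos h3 hs, ?_⟩
  have hz : riemannZeta (2 * s) ≠ 0 := riemannZeta_ne_zero_of_one_lt_re (by simp; linarith)
  have hthree : 1 - (3 : ℂ) ^ (-2 * s) ≠ 0 := by
    exact_mod_cast one_sub_natCast_cpow_ne_zero (m := 3) (by norm_num) hs
  have hprod : ∏ p ∈ n.primeFactors, (1 - (p : ℂ) ^ (-2 * s)) ≠ 0 :=
    Finset.prod_ne_zero_iff.2 fun p hp =>
      one_sub_natCast_cpow_ne_zero (Nat.prime_of_mem_primeFactors hp).one_lt hs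
  have hn : (n : ℂ) ≠ 0 := by exact_mod_cast hpos.ne'
  rw [F, hsum.tsum_eq, characterWeight_eq hpos, Lk_eq_mul_primitiveSum hpos h3 hs,
    Finset.prod_div_distrib]
  push_cast
  generalize 1 - (3 : ℂ) ^ (-2 * s) = x at *
  generalize ∏ p ∈ n.primeFactors, (1 - (p : ℂ) ^ (-2 * s)) = y at *
  field_simp
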